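/- All registers are finite dimensional. For states $\rho,\sigma$ let $F(\rho,\sigma)=\|\sqrt\rho\sqrt\sigma\|_1$ and $h(\rho,\sigma)=\sqrt{1-F(\rho,\sigma)}$; a pure state vector also denotes its density matrix, and an isometry $V$ acts by $V(\rho)=V\rho V^\dagger$. **Protocols.** Let $\Pi$ be an $r$-round quantum communication protocol with pre-shared entanglement. Alice holds a classical input in register $X$, Bob in register $Y$. They share a pure state $\psi_{A_0B_0}$, and $C_0$ is trivial. In odd rounds $i$ Alice applies an isometry $U_i:XA_{i-1}C_{i-1}\to XA_iC_i$ controlled by $X$ and sends $C_i$ (with $B_i=B_{i-1}$); in even rounds $i$ Bob applies an isometry $U_i:YB_{i-1}C_{i-1}\to YB_iC_i$ controlled by $Y$ and sends $C_i$ (with $A_i=A_{i-1}$). For an input distribution $\mu$ on pairs $(x,y)$ let $|\mu\rangle_{XR_XYR_Y}=\sum_{x,y}\sqrt{\mu(x,y)}\,|xxyy\rangle$ be its canonical purification, and let $\mu^i=U_i\cdots U_1(|\mu\rangle\otimes\psi)$ be the global pure state in round $i$, on $XR_XYR_YA_iB_iC_i$. **Inputs.** Let $\rho_{XY}=\rho_X\otimes\rho_Y$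 be a product distribution and $\sigma_{XY}$ a distribution with the same marginals, $\sigma_X=\rho_X$ and $\sigma_Y=\rho_Y$, with round-$i$ states $\rho^i,\sigma^i$. Let $\epsilon_0=0$ and, for $1\le i\le r$, $$\epsilon_i=h\big(\rho^i_{R_XYR_YB_iC_i},\ \rho^i_{R_X}\otimes\rho^i_{YR_YB_iC_i}\big)\ (i\text{ odd}),\qquad \epsilon_i=h\big(\rho^i_{R_YXR_XA_iC_i},\ \rho^i_{R_Y}\otimes\rho^i_{XR_XA_iC_i}\big)\ (i\text{ even}).$$ **Local isometries.** A tilde denotes a fresh register of the same dimension. Let $V^0:YB_0\to Y\tilde B_0\tilde Y_0\tilde R_{Y_0}$ keep $Y$ and $B_0$ (renamed $\tilde B_0$) and create the canonical purification $|\rho_Y\rangle_{\tilde Y_0\tilde R_{Y_0}}$. For odd $i$, $1\le i\le r$, let $V^i:XA_i\to X\tilde A_i\tilde X_i\tilde R_{X_i}$ be an isometry with $$h\big(V^i(\rho^i),\ \rho_{XR_X}\otimes\rho^i_{\tilde X_i\tilde R_{X_i}YR_Y\tilde A_iB_iC_i}\big)=\epsilon_i,$$ and for even $i$, $2\le i\le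 r$, let $V^i:YB_i\to Y\tilde B_i\tilde Y_i\tilde R_{Y_i}$ be an isometry with $$h\big(V^i(\rho^i),\ \rho_{YR_Y}\otimes\rho^i_{XR_X\tilde Y_i\tilde R_{Y_i}A_i\tilde B_iC_i}\big)=\epsilon_i.$$ **Claim.** Such isometries $V^1,\dots,V^r$ exist. Moreover, for every choice of such isometries and every $1\le i\le r$, the quantities $$\gamma_i=h\big(V^iV^{i-1}(\rho^i),\ \rho_{XR_XYR_Y}\otimes\tilde\rho^{\,i}\big),\qquad \delta_i=h\big(V^iV^{i-1}(\sigma^i),\ \sigma_{XR_XYR_Y}\otimes\tilde\rho^{\,i}\big)$$ satisfy $$\gamma_i\le\epsilon_i+\epsilon_{i-1}+2\sum_{j=1}^{i-2}\epsilon_j,\qquad \delta_i\le\epsilon_i+\epsilon_{i-1}+2\sum_{j=1}^{i-2}\epsilon_j.$$ Here $\tilde\rho^{\,i}$ is the copy of $\rho^i$ on $\tilde X\tilde R_X\tilde Y\tilde R_Y\tilde A_i\tilde B_iC_i$, where $\tilde X\tilde R_X$ and $\tilde Y\tilde R_Y$ are the registers created by $V^i$ and $V^{i-1}$. -/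

import Mathlib

namespace QComm

noncomputable section

open scoped Matrix Kronecker MatrixOrder ComplexOrder

/-! ### Density matrices, fidelity, Hellinger distance -/

/-- The trace norm `Tr √(Mᴴ M)`. -/
def traceNorm {I : Type*} [Fintype I] [DecidableEq I] (M : Matrix I I ℂ) : ℝ :=
  (CFC.sqrt (Mᴴ * M)).trace.re

/-- The fidelity `‖√ρ √σ‖₁`. -/
def fidelity {I : Type*} [Fintype I] [DecidableEq I] (ρ σ : Matrix I I ℂ) : ℝ :=
  traceNorm (CFC.sqrt ρ * CFC.sqrt σ)

/-- The Hellinger distance `√(1 - F(ρ, σ))`. -/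
def hellinger {I : Type*} [Fintype I] [DecidableEq I] (ρ σ : Matrix I I ℂ) : ℝ :=
  Real.sqrt (1 - fidelity ρ σ)

/-- The density matrix `|φ⟩⟨φ|` of a vector. -/
def pure {I : Type*} (φ : I → ℂ) : Matrix I I ℂ := Matrix.vecMulVec φ (star φ)

/-- Marginal (partial trace): the registers `I` are split, through `f`, into the traced-out
registers `E` and the kept registers `K`. -/
def marginal {E K I : Type*} [Fintype E] (f : E → K → I) (M : Matrix I I ℂ) : Matrix K K ℂ :=
  Matrix.of fun k k' => ∑ e, M (f e k) (f e k')

/-- The tensor product of two vectors. -/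
def tensor {I J : Type*} (φ : I → ℂ) (ψ : J → ℂ) : I × J → ℂ := fun s => φ s.1 * ψ s.2

/-- Canonical purification `∑ₓ √p(x) |x x⟩` of a distribution. -/
def canon {X : Type*} [DecidableEq X] (p : X → ℝ) : X × X → ℂ :=
  fun (x, x') => if x = x' then (Real.sqrt (p x) : ℂ) else 0

/-- Canonical purification `∑ √μ(x,y) |x x y y⟩`, on registers `X R_X Y R_Y`, of a distribution
of input pairs. -/
def canonPair {X Y : Type*} [DecidableEq X] [DecidableEq Y] (μ : X × Y → ℝ) :
    X × X × Y × Y → ℂ :=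
  fun (x, x', y, y') => if x = x' ∧ y = y' then (Real.sqrt (μ (x, y)) : ℂ) else 0

/-- The product distribution. -/
def prodDist {X Y : Type*} (p : X → ℝ) (q : Y → ℝ) : X × Y → ℝ := fun s => p s.1 * q s.2

/-- Computational-basis labels of the registers `X R_X Y R_Y A B C`, in this order, where
`A`, `B`, `C` have dimensions `a`, `b`, `c`. -/
abbrev Reg (X Y : Type*) (a b c : ℕ) := X × X × Y × Y × Fin a × Fin b × Fin c

instance {X Y : Type*} [DecidableEq X] [DecidableEq Y] {a b c : ℕ} : DecidableEq (Reg X Y a b c) :=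
  @instDecidableEqProd _ _ inferInstance <| @instDecidableEqProd _ _ inferInstance inferInstance

/-! ### Protocols -/

/-- An `r`-round entanglement-assisted protocol with quantum messages, in which Alice (with input
register `X`) sends the odd messages and Bob (with input register `Y`) the even ones.
The isometries are control-isometries, i.e. of the form `∑ₓ |x⟩⟨x| ⊗ Uₓ`, and are given through
their blocks. Data with an index beyond round `r` are irrelevant. The final local processing after
the last message does not affect the states of rounds `≤ r` and is not recorded. -/
structure Protocol (r : ℕ) (X Y : Type*) where
  /-- dimension of Alice's memory after `k` moves of hers: this is the register `A_{2k-1} = A_{2k}`,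
  and for `k = 0` her share of the entanglement -/
  dA : ℕ → ℕ
  /-- dimension of Bob's memory after `k` moves of his: this is the register `B_{2k} = B_{2k+1}`,
  and for `k = 0` his share of the entanglement -/
  dB : ℕ → ℕ
  /-- dimension of the message `C_{2k+1}` from Alice to Bob -/
  dCA : ℕ → ℕ
  /-- dimension of the message `C_{2k}` from Bob to Alice, with `C_0` trivial -/
  dCB : ℕ → ℕ
  dCB_zero : dCB 0 = 1
  /-- pre-shared entangled pure state -/
  ent : Fin (dA 0) × Fin (dB 0) → ℂ
  ent_unit : ∑ s, ‖ent s‖ ^ 2 = 1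
  /-- Alice's operation in round `2k+1`, controlled on her input -/
  UA (k : ℕ) (x : X) : Matrix (Fin (dA (k + 1)) × Fin (dCA k)) (Fin (dA k) × Fin (dCB k)) ℂ
  /-- Bob's operation in round `2k+2`, controlled on his input -/
  UB (k : ℕ) (y : Y) : Matrix (Fin (dB (k + 1)) × Fin (dCB (k + 1))) (Fin (dB k) × Fin (dCA k)) ℂ
  UA_isometry : ∀ k, 2 * k + 1 ≤ r → ∀ x, (UA k x)ᴴ * UA k x = 1
  UB_isometry : ∀ k, 2 * k + 2 ≤ r → ∀ y, (UB k y)ᴴ * UB k y = 1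

/-- A matrix acting on `X A` (with output on `X Ã X̃ R̃_X`), applied to a vector on
`X R_X Y R_Y A B C`. The output registers are ordered `X R_X`, then `X̃ R̃_X Y R_Y Ã B C`. -/
def applyA {X Y : Type*} [Fintype X] {a b c : ℕ}
    (V : Matrix (X × Fin a × X × X) (X × Fin a) ℂ) (φ : Reg X Y a b c → ℂ) :
    (X × X) × Reg X Y a b c → ℂ :=
  fun ((x, rx), (x', rx', y, ry, a', b, c)) =>
    ∑ x₀, ∑ a₀, V (x, a', x', rx') (x₀, a₀) * φ (x₀, rx, y, ry, a₀, b, c)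

/-- A matrix acting on `Y B` (with output on `Y B̃ Ỹ R̃_Y`), applied to a vector on
`X R_X Y R_Y A B C`. The output registers are ordered `Y R_Y`, then `X R_X Ỹ R̃_Y A B̃ C`. -/
def applyB {X Y : Type*} [Fintype Y] {a b c : ℕ}
    (V : Matrix (Y × Fin b × Y × Y) (Y × Fin b) ℂ) (φ : Reg X Y a b c → ℂ) :
    (Y × Y) × Reg X Y a b c → ℂ :=
  fun ((y, ry), (x, rx, y', ry', a, b', c)) =>
    ∑ y₀, ∑ b₀, V (y, b', y', ry') (y₀, b₀) * φ (x, rx, y₀, ry, a, b₀, c)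

/-- Both of the above at once; they act on different registers, so that the order does not matter.
The output registers are ordered `X R_X Y R_Y`, then `X̃ R̃_X Ỹ R̃_Y Ã B̃ C`. -/
def applyAB {X Y : Type*} [Fintype X] [Fintype Y] {a b c : ℕ}
    (V : Matrix (X × Fin a × X × X) (X × Fin a) ℂ)
    (W : Matrix (Y × Fin b × Y × Y) (Y × Fin b) ℂ) (φ : Reg X Y a b c → ℂ) :
    (X × X × Y × Y) × Reg X Y a b c → ℂ :=
  fun ((x, rx, y, ry), (x', rx', y', ry', a', b', c)) =>
    ∑ x₀, ∑ a₀, V (x, a', x', rx') (x₀, a₀) *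
      ∑ y₀, ∑ b₀, W (y, b', y', ry') (y₀, b₀) * φ (x₀, rx, y₀, ry, a₀, b₀, c)

namespace Protocol

variable {r : ℕ} {X Y : Type*} [Fintype X] [DecidableEq X] [Fintype Y] [DecidableEq Y]

/-- The state in round `2k+1`, given the one in round `2k`: Alice moves. -/
def stepA (P : Protocol r X Y) (k : ℕ)
    (φ : Reg X Y (P.dA k) (P.dB k) (P.dCB k) → ℂ) :
    Reg X Y (P.dA (k + 1)) (P.dB k) (P.dCA k) → ℂ :=
  fun (x, rx, y, ry, a, b, c) =>
    ∑ a₀, ∑ c₀, P.UA k x (a, c) (a₀, c₀) * φ (x, rx, y, ry, a₀, b, c₀)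

/-- The state in round `2k+2`, given the one in round `2k+1`: Bob moves. -/
def stepB (P : Protocol r X Y) (k : ℕ)
    (φ : Reg X Y (P.dA (k + 1)) (P.dB k) (P.dCA k) → ℂ) :
    Reg X Y (P.dA (k + 1)) (P.dB (k + 1)) (P.dCB (k + 1)) → ℂ :=
  fun (x, rx, y, ry, a, b, c) =>
    ∑ b₀, ∑ c₀, P.UB k y (b, c) (b₀, c₀) * φ (x, rx, y, ry, a, b₀, c₀)

/-- The global pure state in round `2k` when the input is distributed according to `μ`
(round `0` is the canonical purification of the input together with the entanglement). -/
def evenState (P : Protocol r X Y) (μ : X × Y → ℝ) :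
    (k : ℕ) → Reg X Y (P.dA k) (P.dB k) (P.dCB k) → ℂ
  | 0 => fun (x, rx, y, ry, a, b, _) => canonPair μ (x, rx, y, ry) * P.ent (a, b)
  | k + 1 => P.stepB k (P.stepA k (evenState P μ k))

/-- The global pure state in round `2k+1` when the input is distributed according to `μ`. -/
def oddState (P : Protocol r X Y) (μ : X × Y → ℝ) (k : ℕ) :
    Reg X Y (P.dA (k + 1)) (P.dB k) (P.dCA k) → ℂ :=
  P.stepA k (P.evenState μ k)

/-- `h(ρ_{R_X Y R_Y B C}, ρ_{R_X} ⊗ ρ_{Y R_Y B C})` for the state `ρ` of round `2k+1`. -/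
def errA (P : Protocol r X Y) (p : X → ℝ) (q : Y → ℝ) (k : ℕ) : ℝ :=
  let M := pure (P.oddState (prodDist p q) k)
  hellinger
    (marginal (fun (x, a) (rx, y, ry, b, c) => (x, rx, y, ry, a, b, c)) M :
      Matrix (X × Y × Y × Fin (P.dB k) × Fin (P.dCA k)) _ ℂ)
    ((marginal (fun (x, y, ry, a, b, c) rx => (x, rx, y, ry, a, b, c)) M : Matrix X X ℂ) ⊗ₖ
      (marginal (fun (x, rx, a) (y, ry, b, c) => (x, rx, y, ry, a, b, c)) M :
        Matrix (Y × Y × Fin (P.dB k) × Fin (P.dCA k)) _ ℂ))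

/-- `h(ρ_{R_Y X R_X A C}, ρ_{R_Y} ⊗ ρ_{X R_X A C})` for the state `ρ` of round `2k`. -/
def errB (P : Protocol r X Y) (p : X → ℝ) (q : Y → ℝ) (k : ℕ) : ℝ :=
  let M := pure (P.evenState (prodDist p q) k)
  hellinger
    (marginal (fun (y, b) (ry, x, rx, a, c) => (x, rx, y, ry, a, b, c)) M :
      Matrix (Y × X × X × Fin (P.dA k) × Fin (P.dCB k)) _ ℂ)
    ((marginal (fun (x, rx, y, a, b, c) ry => (x, rx, y, ry, a, b, c)) M : Matrix Y Y ℂ) ⊗ₖ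
      (marginal (fun (y, ry, b) (x, rx, a, c) => (x, rx, y, ry, a, b, c)) M :
        Matrix (X × X × Fin (P.dA k) × Fin (P.dCB k)) _ ℂ))

/-- The per-round errors `ε_i` under the product input distribution `p ⊗ q`. -/
def eps (P : Protocol r X Y) (p : X → ℝ) (q : Y → ℝ) (i : ℕ) : ℝ :=
  if i = 0 then 0 else if Even i then P.errB p q (i / 2) else P.errA p q (i / 2)

/-- The isometry `V⁰`: it keeps `Y` and `B_0` and creates the canonical purification of `q` on
`Ỹ R̃_Y`. -/
def initialV (P : Protocol r X Y) (q : Y → ℝ) :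
    Matrix (Y × Fin (P.dB 0) × Y × Y) (Y × Fin (P.dB 0)) ℂ :=
  Matrix.of fun (y, b, y', ry') (y₀, b₀) => if y = y₀ ∧ b = b₀ then canon q (y', ry') else 0

/-- The local isometries `V^i`, `0 ≤ i ≤ r`: here `V^{2k+1} = VA (k + 1)` acts on `X A_{2k+1}` and
`V^{2k} = VB k` acts on `Y B_{2k}` (`VA 0` and the ones beyond round `r` are irrelevant). For
`i ≥ 1` they attain the error `ε_i` on the global states. -/
structure IsDecoupling (P : Protocol r X Y) (p : X → ℝ) (q : Y → ℝ)
    (VA : (k : ℕ) → Matrix (X × Fin (P.dA k) × X × X) (X × Fin (P.dA k)) ℂ)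
    (VB : (k : ℕ) → Matrix (Y × Fin (P.dB k) × Y × Y) (Y × Fin (P.dB k)) ℂ) : Prop where
  zero : VB 0 = P.initialV q
  isometryA : ∀ k, 2 * k + 1 ≤ r → (VA (k + 1))ᴴ * VA (k + 1) = 1
  isometryB : ∀ k, 2 * k + 2 ≤ r → (VB (k + 1))ᴴ * VB (k + 1) = 1
  attainA : ∀ k, 2 * k + 1 ≤ r → P.eps p q (2 * k + 1) =
    hellinger (pure (applyA (VA (k + 1)) (P.oddState (prodDist p q) k)))
      (pure (tensor (canon p) (P.oddState (prodDist p q) k)))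
  attainB : ∀ k, 2 * k + 2 ≤ r → P.eps p q (2 * k + 2) =
    hellinger (pure (applyB (VB (k + 1)) (P.evenState (prodDist p q) (k + 1))))
      (pure (tensor (canon q) (P.evenState (prodDist p q) (k + 1))))

/-- The Hellinger distance, in round `i ≥ 1`, between `V^i V^{i-1}` applied to the global state of
the protocol on input distribution `μ` and the tensor product of the canonical purification of `μ`
with a copy of the round-`i` global state of the protocol on the product distribution `p ⊗ q`.
For `μ = p ⊗ q` this is `γ_i`; for `μ = σ` it is `δ_i`. -/
def jointErr (P : Protocol r X Y) (p : X → ℝ) (q : Y → ℝ) (μ : X × Y → ℝ)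
    (VA : (k : ℕ) → Matrix (X × Fin (P.dA k) × X × X) (X × Fin (P.dA k)) ℂ)
    (VB : (k : ℕ) → Matrix (Y × Fin (P.dB k) × Y × Y) (Y × Fin (P.dB k)) ℂ) (i : ℕ) : ℝ :=
  if Even i then
    hellinger (pure (applyAB (VA (i / 2)) (VB (i / 2)) (P.evenState μ (i / 2))))
      (pure (tensor (canonPair μ) (P.evenState (prodDist p q) (i / 2))))
  else
    hellinger (pure (applyAB (VA (i / 2 + 1)) (VB (i / 2)) (P.oddState μ (i / 2))))
      (pure (tensor (canonPair μ) (P.oddState (prodDist p q) (i / 2))))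

end Protocol

end

end QComm

/-!
The fidelity of two pure states is the modulus of their overlap, so for unit vectors `√2 h(u, v)`
is the least Euclidean distance between `u` and a phase times `v` (`close_hellinger`,
`Close.hellinger_le`). All bounds are proved for that distance, `Close`, which obeys the triangle
inequality and does not grow under contractions, in particular under adjoints of isometries.

*Existence.* `V(ρ^i)` and `ρ_{X R_X} ⊗ ρ̃^i` purify the two states compared in `ε_i`, so Uhlmann's
theorem gives an isometry on the purifying registers that attains their fidelity. It follows from
the polar decomposition of the overlap matrix (`exists_isometry_overlap_eq_fidelity`). The marginal
on `R_X` is constant over the rounds because moves are isometries that do not touch `R_X`.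

*Bounds.* As `ρ` has the marginals of `σ`, `γ_i` is the case `σ = ρ` of `δ_i`. For odd `i`, let
`T = V^i U_i (V^{i-2})†`, an operation on Alice's registers and the message only. It maps
`V^{i-1} V^{i-2}(σ^{i-1})` to `V^i V^{i-1}(σ^i)`, so it is enough to compare
`T(σ_{X R_X Y R_Y} ⊗ ρ̃^{i-1})` with `σ_{X R_X Y R_Y} ⊗ ρ̃^i`. As `T` does not touch `Y`, their
distance depends on `σ` only through its marginal on `X` (`nrm_act_canonPair`), and is the distance
of `T(ρ_{X R_X} ⊗ ρ̃^{i-1})` from `ρ_{X R_X} ⊗ ρ̃^i`. The former is `ε_{i-2}`-close to `V^i(ρ^i)`,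
because the move of Bob in round `i-1` commutes with `V^{i-2}`; and that is `ε_i`-close to the
latter. Hence `δ_i ≤ δ_{i-1} + ε_{i-2} + ε_i` (`Close.applyAB_moveA`), and for even `i` likewise with
the parties exchanged. The recursion starts at round `0` with error `0`, if an isometry of Alice
that creates the canonical purification of `p` stands in for round `-1`; it adds up to the bound
claimed (`accErr_eq`).
-/

namespace QComm

noncomputable section

set_option linter.unusedSectionVars false

open scoped Matrix Kronecker MatrixOrder ComplexOrder

/-! ### Polar decomposition, fidelity and purifications -/

section Fidelity

variable {m n k : Type*} [Fintype m] [DecidableEq m] [Fintype n] [DecidableEq n]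
  [Fintype k] [DecidableEq k]

theorem inner_toEuclideanLin_self (A : Matrix m n ℂ) (x : EuclideanSpace ℂ n) :
    inner ℂ (A.toEuclideanLin x) (A.toEuclideanLin x)
      = inner ℂ x ((Aᴴ * A).toEuclideanLin x) := by
  rw [← LinearMap.adjoint_inner_right, ← Matrix.toEuclideanLin_conjTranspose_eq_adjoint]
  congr 1
  simp [Matrix.toLpLin_apply]

theorem norm_toEuclideanLin_eq {A : Matrix m n ℂ} {B : Matrix k n ℂ} (h : Aᴴ * A = Bᴴ * B)
    (x : EuclideanSpace ℂ n) : ‖A.toEuclideanLin x‖ = ‖B.toEuclideanLin x‖ := by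
  have hA := inner_toEuclideanLin_self A x
  rw [h, ← inner_toEuclideanLin_self B x, inner_self_eq_norm_sq_to_K,
    inner_self_eq_norm_sq_to_K] at hA
  have : ‖A.toEuclideanLin x‖ ^ 2 = ‖B.toEuclideanLin x‖ ^ 2 := by exact_mod_cast hA
  exact (sq_eq_sq₀ (norm_nonneg _) (norm_nonneg _)).1 this

/-- Two linear maps with the same norms of images differ by an isometry of the target space. -/
theorem exists_linearIsometry_comp {V W : Type*} [AddCommGroup V] [Module ℂ V]
    [NormedAddCommGroup W] [InnerProductSpace ℂ W] [FiniteDimensional ℂ W] (f g : V →ₗ[ℂ] W)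
    (h : ∀ x, ‖f x‖ = ‖g x‖) : ∃ L : W →ₗᵢ[ℂ] W, ∀ x, L (f x) = g x := by
  obtain ⟨s, hs⟩ := f.rangeRestrict.exists_rightInverse_of_surjective f.range_rangeRestrict
  have hs' : ∀ y, f (s y) = y := fun y => by
    have := LinearMap.congr_fun hs y
    simpa using congrArg Subtype.val this
  let L : LinearMap.range f →ₗᵢ[ℂ] W := ⟨g ∘ₗ s, fun y => by
    simp only [LinearMap.comp_apply]
    rw [← h, hs']; rfl⟩
  refine ⟨L.extend, fun x => ?_⟩
  have := L.extend_apply ⟨f x, x, rfl⟩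
  refine this.trans ?_
  change g (s ⟨f x, x, rfl⟩) = g x
  rw [← sub_eq_zero, ← map_sub, ← norm_eq_zero, ← h, map_sub, hs', sub_self, norm_zero]

/-- If `AᴴA = BᴴB` and `B` maps to a space at least as large as that of `A`, then `B` is an
isometry times `A`. -/
theorem exists_isometry_mul_eq (hcard : Fintype.card k ≤ Fintype.card m)
    (A : Matrix k n ℂ) (B : Matrix m n ℂ) (h : Aᴴ * A = Bᴴ * B) :
    ∃ W : Matrix m k ℂ, Wᴴ * W = 1 ∧ B = W * A := by
  obtain ⟨ι⟩ := Function.Embedding.nonempty_of_card_le hcard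
  let J : Matrix m k ℂ := Matrix.of fun i j => if i = ι j then 1 else 0
  have hJ : Jᴴ * J = 1 := by
    ext i j
    simp [J, Matrix.mul_apply, Matrix.one_apply, Matrix.conjTranspose_apply, ι.injective.eq_iff,
      eq_comm]
  obtain ⟨L, hL⟩ := exists_linearIsometry_comp (J * A).toEuclideanLin B.toEuclideanLin
    (norm_toEuclideanLin_eq (by
      rw [Matrix.conjTranspose_mul, Matrix.mul_assoc, ← Matrix.mul_assoc Jᴴ, hJ, Matrix.one_mul, h]))
  let U : Matrix m m ℂ := Matrix.toEuclideanLin.symm L.toLinearMap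
  have hU : Uᴴ * U = 1 := by
    apply Matrix.toEuclideanLin.injective
    refine LinearMap.ext fun x => ext_inner_left ℂ fun y => ?_
    have h1 : (Uᴴ * U).toEuclideanLin x = Uᴴ.toEuclideanLin (U.toEuclideanLin x) := by
      simp [Matrix.toLpLin_apply]
    rw [h1, Matrix.toEuclideanLin_conjTranspose_eq_adjoint, LinearMap.adjoint_inner_right]
    simp only [U, LinearEquiv.apply_symm_apply]
    simp
  refine ⟨U * J, ?_, ?_⟩
  · rw [Matrix.conjTranspose_mul, Matrix.mul_assoc, ← Matrix.mul_assoc Uᴴ, hU, Matrix.one_mul, hJ]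
  · apply Matrix.toEuclideanLin.injective
    refine LinearMap.ext fun x => ?_
    have h1 : (U * J * A).toEuclideanLin x = U.toEuclideanLin ((J * A).toEuclideanLin x) := by
      simp [Matrix.toLpLin_apply, Matrix.mul_assoc]
    rw [h1, ← hL]
    simp only [U, LinearEquiv.apply_symm_apply]
    rfl

theorem sqrt_conjTranspose (A : Matrix n n ℂ) : (CFC.sqrt A)ᴴ = CFC.sqrt A :=
  (Matrix.nonneg_iff_posSemidef.1 (CFC.sqrt_nonneg A)).1

theorem sqrt_mul_sqrt_conjTranspose_mul_self (B : Matrix m n ℂ) :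
    CFC.sqrt (Bᴴ * B) * CFC.sqrt (Bᴴ * B) = Bᴴ * B :=
  CFC.sqrt_mul_sqrt_self _ (Matrix.nonneg_iff_posSemidef.2 (Matrix.posSemidef_conjTranspose_mul_self B))

/-- Polar decomposition of a matrix with at least as many rows as columns. -/
theorem exists_polar (hcard : Fintype.card n ≤ Fintype.card m) (B : Matrix m n ℂ) :
    ∃ W : Matrix m n ℂ, Wᴴ * W = 1 ∧ B = W * CFC.sqrt (Bᴴ * B) :=
  exists_isometry_mul_eq hcard _ B (by
    rw [sqrt_conjTranspose, sqrt_mul_sqrt_conjTranspose_mul_self])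

theorem trace_sqrt_conjTranspose_mul_comm_of_card_le (hcard : Fintype.card n ≤ Fintype.card m)
    (B : Matrix m n ℂ) : (CFC.sqrt (Bᴴ * B)).trace = (CFC.sqrt (B * Bᴴ)).trace := by
  obtain ⟨W, hW, hB⟩ := exists_polar hcard B
  have hsa := sqrt_conjTranspose (Bᴴ * B)
  have hnn := Matrix.nonneg_iff_posSemidef.1 (CFC.sqrt_nonneg (Bᴴ * B))
  generalize CFC.sqrt (Bᴴ * B) = P at *
  have : CFC.sqrt (B * Bᴴ) = W * P * Wᴴ := by
    apply CFC.sqrt_unique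
    · rw [hB, Matrix.conjTranspose_mul, hsa]
      calc W * P * Wᴴ * (W * P * Wᴴ) = W * P * (Wᴴ * W) * P * Wᴴ := by
            simp only [Matrix.mul_assoc]
        _ = _ := by rw [hW, Matrix.mul_one]; simp only [Matrix.mul_assoc]
    · exact Matrix.nonneg_iff_posSemidef.2 (hnn.mul_mul_conjTranspose_same W)
  rw [this, Matrix.trace_mul_comm, ← Matrix.mul_assoc, hW, Matrix.one_mul]

theorem trace_sqrt_conjTranspose_mul_comm (B : Matrix m n ℂ) :
    (CFC.sqrt (Bᴴ * B)).trace = (CFC.sqrt (B * Bᴴ)).trace := by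
  rcases le_total (Fintype.card n) (Fintype.card m) with h | h
  · exact trace_sqrt_conjTranspose_mul_comm_of_card_le h B
  · simpa using (trace_sqrt_conjTranspose_mul_comm_of_card_le h Bᴴ).symm

/-- The fidelity of two states in terms of purifications: it is the trace norm of the overlap
matrix of the purifying registers. -/
theorem fidelity_mul_conjTranspose {e e' : Type*} [Fintype e] [DecidableEq e] [Fintype e']
    [DecidableEq e'] (M : Matrix k e ℂ) (N : Matrix k e' ℂ) :
    fidelity (M * Mᴴ) (N * Nᴴ) = (CFC.sqrt ((Nᴴ * M)ᴴ * (Nᴴ * M))).trace.re := by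
  have hM := CFC.sqrt_mul_sqrt_self (M * Mᴴ)
    (Matrix.nonneg_iff_posSemidef.2 (Matrix.posSemidef_self_mul_conjTranspose M))
  have hN := CFC.sqrt_mul_sqrt_self (N * Nᴴ)
    (Matrix.nonneg_iff_posSemidef.2 (Matrix.posSemidef_self_mul_conjTranspose N))
  have h1 : (CFC.sqrt (M * Mᴴ) * CFC.sqrt (N * Nᴴ))ᴴ * (CFC.sqrt (M * Mᴴ) * CFC.sqrt (N * Nᴴ))
      = (Mᴴ * CFC.sqrt (N * Nᴴ))ᴴ * (Mᴴ * CFC.sqrt (N * Nᴴ)) := by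
    simp only [Matrix.conjTranspose_mul, sqrt_conjTranspose, Matrix.conjTranspose_conjTranspose]
    calc _ = CFC.sqrt (N * Nᴴ) * (CFC.sqrt (M * Mᴴ) * CFC.sqrt (M * Mᴴ)) * CFC.sqrt (N * Nᴴ) := by
          simp only [Matrix.mul_assoc]
      _ = _ := by rw [hM]; simp only [Matrix.mul_assoc]
  have h2 : Mᴴ * CFC.sqrt (N * Nᴴ) * (Mᴴ * CFC.sqrt (N * Nᴴ))ᴴ = (Nᴴ * M)ᴴ * (Nᴴ * M) := by
    simp only [Matrix.conjTranspose_mul, sqrt_conjTranspose, Matrix.conjTranspose_conjTranspose]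
    calc _ = Mᴴ * (CFC.sqrt (N * Nᴴ) * CFC.sqrt (N * Nᴴ)) * M := by simp only [Matrix.mul_assoc]
      _ = _ := by rw [hN]; simp only [Matrix.mul_assoc]
  rw [fidelity, traceNorm, h1, trace_sqrt_conjTranspose_mul_comm, h2]

theorem fidelity_pure (u v : k → ℂ) : fidelity (pure u) (pure v) = ‖star v ⬝ᵥ u‖ := by
  have h : ∀ w : k → ℂ, pure w = Matrix.replicateCol Unit w * (Matrix.replicateCol Unit w)ᴴ := by
    intro w
    ext i j
    simp [pure, Matrix.mul_apply, Matrix.vecMulVec_apply]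
  rw [h u, h v, fidelity_mul_conjTranspose]
  have hs : CFC.sqrt (((Matrix.replicateCol Unit v)ᴴ * Matrix.replicateCol Unit u)ᴴ *
      ((Matrix.replicateCol Unit v)ᴴ * Matrix.replicateCol Unit u))
      = Matrix.diagonal fun _ => (‖star v ⬝ᵥ u‖ : ℂ) := by
    apply CFC.sqrt_unique
    · ext i j
      rw [Matrix.diagonal_mul_diagonal, Matrix.mul_apply]
      simp only [Matrix.conjTranspose_apply, Finset.univ_unique, Finset.sum_singleton,
        Matrix.mul_apply, Matrix.replicateCol_apply]
      change _ = star (star v ⬝ᵥ u) * (star v ⬝ᵥ u)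
      rw [Subsingleton.elim i j, Matrix.diagonal_apply_eq]
      simpa [sq] using (Complex.conj_mul' (star v ⬝ᵥ u)).symm
    · exact Matrix.nonneg_iff_posSemidef.2 (Matrix.PosSemidef.diagonal fun _ => by simp)
  rw [hs]
  simp

/-- Attainment in Uhlmann's theorem: a local isometry on the purifying register makes
the overlap of two purifications equal to the fidelity of the purified states. -/
theorem exists_isometry_overlap_eq_fidelity {e e' : Type*} [Fintype e] [DecidableEq e]
    [Fintype e'] [DecidableEq e'] (hcard : Fintype.card e ≤ Fintype.card e')
    (M : Matrix k e ℂ) (N : Matrix k e' ℂ) :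
    ∃ V : Matrix e' e ℂ, Vᴴ * V = 1 ∧
      ‖(Nᴴ * (M * Vᵀ)).trace‖ = fidelity (M * Mᴴ) (N * Nᴴ) := by
  obtain ⟨W, hW, hB⟩ := exists_polar hcard (Nᴴ * M)
  refine ⟨Wᴴᵀ, ?_, ?_⟩
  · rw [← Matrix.transpose_one, ← hW, Matrix.transpose_mul]
    congr 1
    ext i j
    simp
  · rw [fidelity_mul_conjTranspose]
    have hnn := Matrix.nonneg_iff_posSemidef.1 (CFC.sqrt_nonneg ((Nᴴ * M)ᴴ * (Nᴴ * M)))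
    generalize CFC.sqrt ((Nᴴ * M)ᴴ * (Nᴴ * M)) = Q at *
    rw [Matrix.transpose_transpose, ← Matrix.mul_assoc, hB, Matrix.trace_mul_comm,
      ← Matrix.mul_assoc, hW, Matrix.one_mul]
    exact Complex.norm_of_nonneg' hnn.trace_nonneg |> fun h => by
      have := congrArg Complex.re h
      simpa using this

end Fidelity

/-! ### Distance of pure states up to phase -/

section Vectors

variable {I J : Type*} [Fintype I] [Fintype J]

/-- The Euclidean norm of a vector of amplitudes. -/
def nrm (u : I → ℂ) : ℝ := ‖WithLp.toLp 2 u‖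

theorem nrm_sq (u : I → ℂ) : nrm u ^ 2 = ∑ i, ‖u i‖ ^ 2 := EuclideanSpace.norm_sq_eq _

theorem nrm_nonneg (u : I → ℂ) : 0 ≤ nrm u := norm_nonneg _

theorem nrm_add_le (u v : I → ℂ) : nrm (u + v) ≤ nrm u + nrm v := norm_add_le (WithLp.toLp 2 u) _

theorem nrm_smul (c : ℂ) (u : I → ℂ) : nrm (c • u) = ‖c‖ * nrm u := norm_smul c (WithLp.toLp 2 u)

theorem nrm_comp_equiv (e : J ≃ I) (u : I → ℂ) : nrm (u ∘ e) = nrm u := by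
  rw [← sq_eq_sq₀ (nrm_nonneg _) (nrm_nonneg _), nrm_sq, nrm_sq]
  exact Equiv.sum_comp e fun i => ‖u i‖ ^ 2

/-- Up to a global phase, `u` is within `√2 * e` of `v`. For unit vectors, the least such `e` is
the Hellinger distance of the corresponding pure states. -/
def Close (u v : I → ℂ) (e : ℝ) : Prop := ∃ c : ℂ, ‖c‖ = 1 ∧ nrm (u - c • v) ≤ √2 * e

theorem Close.refl (u : I → ℂ) : Close u u 0 := ⟨1, by simp, by simp [nrm]⟩

theorem Close.symm {u v : I → ℂ} {e : ℝ} (h : Close u v e) : Close v u e := by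
  obtain ⟨c, hc, h⟩ := h
  have hc0 : c ≠ 0 := by rintro rfl; simp at hc
  refine ⟨c⁻¹, by simp [hc], le_of_eq_of_le ?_ h⟩
  have : v - c⁻¹ • u = (-c⁻¹) • (u - c • v) := by
    rw [smul_sub, smul_smul]; simp [hc0]; abel
  rw [this, nrm_smul]
  simp [hc]

theorem Close.trans {u v w : I → ℂ} {e f : ℝ} (h : Close u v e) (h' : Close v w f) :
    Close u w (e + f) := by
  obtain ⟨c, hc, h⟩ := h
  obtain ⟨d, hd, h'⟩ := h'
  refine ⟨c * d, by simp [hc, hd], ?_⟩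
  have : u - (c * d) • w = (u - c • v) + c • (v - d • w) := by
    rw [smul_sub, smul_smul]; abel
  rw [this]
  refine (nrm_add_le _ _).trans ?_
  rw [nrm_smul, hc]
  linarith

theorem Close.comp_equiv (e : J ≃ I) {u v : I → ℂ} {d : ℝ} (h : Close u v d) :
    Close (u ∘ e) (v ∘ e) d := by
  obtain ⟨c, hc, h⟩ := h
  exact ⟨c, hc, (nrm_comp_equiv e (u - c • v)).trans_le h⟩

theorem close_comp_equiv_iff (e : J ≃ I) {u v : I → ℂ} {d : ℝ} :
    Close (u ∘ e) (v ∘ e) d ↔ Close u v d :=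
  ⟨fun h => by simpa [Function.comp_assoc] using h.comp_equiv e.symm, fun h => h.comp_equiv e⟩

theorem nrm_sub_smul_sq {u v : I → ℂ} (hu : nrm u = 1) (hv : nrm v = 1) {c : ℂ} (hc : ‖c‖ = 1) :
    nrm (u - c • v) ^ 2 = 2 - 2 * (c * star (star v ⬝ᵥ u)).re := by
  have h := norm_sub_sq (𝕜 := ℂ) (WithLp.toLp 2 u) (c • WithLp.toLp 2 v)
  rw [norm_smul, hc, inner_smul_right, EuclideanSpace.inner_eq_star_dotProduct] at h
  have e : WithLp.ofLp (WithLp.toLp 2 v) ⬝ᵥ star (WithLp.ofLp (WithLp.toLp 2 u))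
      = star (star v ⬝ᵥ u) := by
    rw [Matrix.star_dotProduct, star_star]; exact dotProduct_comm v (star u)
  rw [e] at h
  change ‖WithLp.toLp 2 (u - c • v)‖ ^ 2 = _
  change ‖WithLp.toLp 2 (u - c • v)‖ ^ 2 = _ at h
  rw [h]
  change nrm u ^ 2 - _ + (1 * nrm v) ^ 2 = _
  rw [hu, hv]
  change 1 ^ 2 - 2 * (c * star (star v ⬝ᵥ u)).re + (1 * 1) ^ 2 = _
  ring

variable [DecidableEq I]

theorem close_hellinger {u v : I → ℂ} (hu : nrm u = 1) (hv : nrm v = 1) :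
    Close u v (hellinger (pure u) (pure v)) := by
  rw [hellinger, fidelity_pure]
  set z := star v ⬝ᵥ u with hz
  -- the phase that makes the overlap real and nonnegative
  obtain ⟨c, hc, hcz⟩ : ∃ c : ℂ, ‖c‖ = 1 ∧ c * star z = ‖z‖ := by
    by_cases h : z = 0
    · exact ⟨1, by simp, by simp [h]⟩
    · have hn : (‖z‖ : ℂ) ≠ 0 := by simpa using h
      refine ⟨z / ‖z‖, by simp [h], ?_⟩
      rw [div_mul_eq_mul_div, div_eq_iff hn]
      simpa [sq] using Complex.mul_conj' z
  have h := nrm_sub_smul_sq hu hv hc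
  rw [← hz, hcz, Complex.ofReal_re] at h
  refine ⟨c, hc, ?_⟩
  rw [← Real.sqrt_mul (by norm_num), ← Real.sqrt_sq (nrm_nonneg _), h]
  exact le_of_eq (by ring_nf)

theorem Close.hellinger_le {u v : I → ℂ} (hu : nrm u = 1) (hv : nrm v = 1) {e : ℝ}
    (h : Close u v e) : hellinger (pure u) (pure v) ≤ e := by
  obtain ⟨c, hc, h⟩ := h
  have h2 := nrm_sub_smul_sq hu hv hc
  have h3 : (c * star (star v ⬝ᵥ u)).re ≤ ‖star v ⬝ᵥ u‖ :=
    (Complex.re_le_norm _).trans (by rw [norm_mul, hc, norm_star, one_mul])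
  have he : √2 * hellinger (pure u) (pure v) ≤ √2 * e := by
    refine le_trans ?_ h
    rw [hellinger, fidelity_pure, ← Real.sqrt_mul (by norm_num)]
    exact Real.sqrt_le_iff.2 ⟨nrm_nonneg _, by rw [h2]; linarith⟩
  exact le_of_mul_le_mul_left he (by positivity)

end Vectors

/-! ### Matrices acting on one of two registers -/

section LocalAction

variable {Z Z' Z'' K L : Type*} [Fintype Z] [Fintype Z'] [Fintype Z''] [Fintype K] [Fintype L]

/-- A matrix acting on the first of two registers. -/
def act (M : Matrix Z' Z ℂ) (v : Z × K → ℂ) : Z' × K → ℂ :=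
  fun s => ∑ z, M s.1 z * v (z, s.2)

theorem act_mul (N : Matrix Z'' Z' ℂ) (M : Matrix Z' Z ℂ) (v : Z × K → ℂ) :
    act (N * M) v = act N (act M v) := by
  ext ⟨z, k⟩
  simp only [act, Matrix.mul_apply, Finset.sum_mul, Finset.mul_sum, mul_assoc]
  exact Finset.sum_comm

theorem act_one [DecidableEq Z] (v : Z × K → ℂ) : act (1 : Matrix Z Z ℂ) v = v := by
  ext ⟨z, k⟩
  simp [act, Matrix.one_apply]

theorem act_sub_smul (M : Matrix Z' Z ℂ) (c : ℂ) (u v : Z × K → ℂ) :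
    act M (u - c • v) = act M u - c • act M v := by
  ext ⟨z, k⟩
  simp only [act, Pi.sub_apply, Pi.smul_apply, smul_eq_mul, mul_sub, Finset.sum_sub_distrib,
    Finset.mul_sum]
  congr 1
  exact Finset.sum_congr rfl fun _ _ => by ring

theorem nrm_sq_prod (v : Z × K → ℂ) : nrm v ^ 2 = ∑ k, nrm (fun z => v (z, k)) ^ 2 := by
  simp only [nrm_sq]
  rw [Fintype.sum_prod_type, Finset.sum_comm]

theorem nrm_sq_prod₃ (v : Z × K × L → ℂ) :
    nrm v ^ 2 = ∑ z, ∑ k, ∑ l, ‖v (z, k, l)‖ ^ 2 := by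
  simp only [nrm_sq, Fintype.sum_prod_type]

/-- A matrix that does not increase Euclidean norms. -/
def IsContraction (M : Matrix Z' Z ℂ) : Prop := ∀ u : Z → ℂ, nrm (M *ᵥ u) ≤ nrm u

theorem IsContraction.mul {N : Matrix Z'' Z' ℂ} {M : Matrix Z' Z ℂ} (hN : IsContraction N)
    (hM : IsContraction M) : IsContraction (N * M) := fun u => by
  rw [← Matrix.mulVec_mulVec]
  exact (hN _).trans (hM _)

section
open scoped Matrix.Norms.L2Operator

theorem isContraction_of_norm_le [DecidableEq Z] {M : Matrix Z' Z ℂ} (h : ‖M‖ ≤ 1) :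
    IsContraction M := fun u =>
  (Matrix.l2_opNorm_mulVec M (WithLp.toLp 2 u)).trans (mul_le_of_le_one_left (norm_nonneg _) h)

theorem norm_le_one_of_isometry [DecidableEq Z] {M : Matrix Z' Z ℂ} (h : Mᴴ * M = 1) :
    ‖M‖ ≤ 1 := by
  have h1 := Matrix.l2_opNorm_conjTranspose_mul_self M
  have h2 : ‖(1 : Matrix Z Z ℂ)‖ ≤ 1 := by
    rw [← Matrix.diagonal_one, Matrix.l2_opNorm_diagonal, pi_norm_le_iff_of_nonneg zero_le_one]
    simp
  rw [h] at h1
  nlinarith [norm_nonneg M]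

theorem isContraction_of_isometry [DecidableEq Z] {M : Matrix Z' Z ℂ} (h : Mᴴ * M = 1) :
    IsContraction M :=
  isContraction_of_norm_le (norm_le_one_of_isometry h)

theorem isContraction_conjTranspose [DecidableEq Z] [DecidableEq Z'] {M : Matrix Z' Z ℂ}
    (h : Mᴴ * M = 1) : IsContraction Mᴴ :=
  isContraction_of_norm_le (by
    rw [Matrix.l2_opNorm_conjTranspose]; exact norm_le_one_of_isometry h)

end

theorem IsContraction.nrm_act_le {M : Matrix Z' Z ℂ} (hM : IsContraction M) (v : Z × K → ℂ) :
    nrm (act M v) ≤ nrm v := by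
  rw [← sq_le_sq₀ (nrm_nonneg _) (nrm_nonneg _), nrm_sq_prod, nrm_sq_prod]
  refine Finset.sum_le_sum fun k _ => pow_le_pow_left₀ (nrm_nonneg _) ?_ 2
  exact hM fun z => v (z, k)

theorem nrm_act_of_isometry [DecidableEq Z] [DecidableEq Z'] {M : Matrix Z' Z ℂ} (h : Mᴴ * M = 1)
    (v : Z × K → ℂ) : nrm (act M v) = nrm v := by
  refine le_antisymm ((isContraction_of_isometry h).nrm_act_le v) ?_
  have := (isContraction_conjTranspose h).nrm_act_le (act M v)
  rwa [← act_mul, h, act_one] at this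

theorem Close.map_act {M : Matrix Z' Z ℂ} (hM : IsContraction M) {u v : Z × K → ℂ} {e : ℝ}
    (h : Close u v e) : Close (act M u) (act M v) e := by
  obtain ⟨c, hc, h⟩ := h
  refine ⟨c, hc, ?_⟩
  rw [← act_sub_smul]
  exact (hM.nrm_act_le _).trans h

theorem nrm_tensor (u : Z → ℂ) (v : K → ℂ) : nrm (tensor u v) = nrm u * nrm v := by
  rw [← sq_eq_sq₀ (nrm_nonneg _) (mul_nonneg (nrm_nonneg _) (nrm_nonneg _)), mul_pow]
  simp only [nrm_sq, tensor, norm_mul, mul_pow, Fintype.sum_prod_type, Finset.sum_mul_sum]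

end LocalAction

/-! ### Moves of Alice -/

variable {X Y : Type*} [Fintype X] [DecidableEq X] [Fintype Y] [DecidableEq Y]
  {a a' b b' c c' : ℕ}

/-- A move of Alice: a matrix on her memory and the message, controlled by her input. -/
def moveA (U : X → Matrix (Fin a' × Fin c') (Fin a × Fin c) ℂ) (φ : Reg X Y a b c → ℂ) :
    Reg X Y a' b c' → ℂ :=
  fun (x, rx, y, ry, a, b, c) => ∑ a₀, ∑ c₀, U x (a, c) (a₀, c₀) * φ (x, rx, y, ry, a₀, b, c₀)

/-- The matrix `∑ₓ |x⟩⟨x| ⊗ Uₓ`. -/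
def ctrl (U : X → Matrix (Fin a' × Fin c') (Fin a × Fin c) ℂ) :
    Matrix ((X × Fin a') × Fin c') ((X × Fin a) × Fin c) ℂ :=
  Matrix.of fun ((x, a), c) ((x₀, a₀), c₀) => if x = x₀ then U x (a, c) (a₀, c₀) else 0

/-- Groups the registers as (those touched by Alice) × (the others). -/
def regEquiv : ((X × Fin a) × Fin c) × (X × Y × Y × Fin b) ≃ Reg X Y a b c where
  toFun := fun (((x, a), c), (rx, y, ry, b)) => (x, rx, y, ry, a, b, c)
  invFun := fun (x, rx, y, ry, a, b, c) => (((x, a), c), (rx, y, ry, b))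
  left_inv _ := rfl
  right_inv _ := rfl

/-- The grouping of `regEquiv`, after Alice's local isometry created further registers. -/
def regEquivA : ((X × Fin a × X × X) × Fin c) × (X × Y × Y × Fin b) ≃ (X × X) × Reg X Y a b c where
  toFun := fun (((x, a, x', rx'), c), (rx, y, ry, b)) => ((x, rx), (x', rx', y, ry, a, b, c))
  invFun := fun ((x, rx), (x', rx', y, ry, a, b, c)) => (((x, a, x', rx'), c), (rx, y, ry, b))
  left_inv _ := rfl
  right_inv _ := rfl

/-- The grouping of `regEquiv`, after both local isometries created further registers. -/
def regEquivAB : ((X × Fin a × X × X) × Fin c) × (X × Y × Y × Y × Y × Fin b) ≃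
    (X × X × Y × Y) × Reg X Y a b c where
  toFun := fun (((x, a, x', rx'), c), (rx, y, ry, y', ry', b)) =>
    ((x, rx, y, ry), (x', rx', y', ry', a, b, c))
  invFun := fun ((x, rx, y, ry), (x', rx', y', ry', a, b, c)) =>
    (((x, a, x', rx'), c), (rx, y, ry, y', ry', b))
  left_inv _ := rfl
  right_inv _ := rfl

/-- Bob's local isometry, with the output grouped as in `regEquivAB`. -/
def partB (W : Matrix (Y × Fin b × Y × Y) (Y × Fin b) ℂ) (φ : Reg X Y a b c → ℂ) :
    ((X × Fin a) × Fin c) × (X × Y × Y × Y × Y × Fin b) → ℂ :=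
  fun (((x, a), c), (rx, y, ry, y', ry', b)) =>
    ∑ y₀, ∑ b₀, W (y, b, y', ry') (y₀, b₀) * φ (x, rx, y₀, ry, a, b₀, c)

theorem moveA_regEquiv (U : X → Matrix (Fin a' × Fin c') (Fin a × Fin c) ℂ)
    (φ : Reg X Y a b c → ℂ) : moveA U φ ∘ regEquiv = act (ctrl U) (φ ∘ regEquiv) := by
  ext ⟨⟨⟨x, a⟩, c⟩, rx, y, ry, b⟩
  simp [act, ctrl, moveA, regEquiv, Fintype.sum_prod_type, Finset.sum_ite_irrel]

theorem applyA_regEquivA (V : Matrix (X × Fin a × X × X) (X × Fin a) ℂ)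
    (φ : Reg X Y a b c → ℂ) :
    applyA V φ ∘ regEquivA = act (V ⊗ₖ (1 : Matrix (Fin c) (Fin c) ℂ)) (φ ∘ regEquiv) := by
  ext ⟨⟨⟨x, a, x', rx'⟩, c⟩, rx, y, ry, b⟩
  simp [act, applyA, regEquivA, regEquiv, Fintype.sum_prod_type, Matrix.one_apply]

theorem applyAB_regEquivAB (V : Matrix (X × Fin a × X × X) (X × Fin a) ℂ)
    (W : Matrix (Y × Fin b × Y × Y) (Y × Fin b) ℂ) (φ : Reg X Y a b c → ℂ) :
    applyAB V W φ ∘ regEquivAB =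
      act (V ⊗ₖ (1 : Matrix (Fin c) (Fin c) ℂ)) (partB W φ) := by
  ext ⟨⟨⟨x, a, x', rx'⟩, c⟩, rx, y, ry, y', ry', b⟩
  simp [act, applyAB, regEquivAB, partB, Fintype.sum_prod_type, Matrix.one_apply]

theorem partB_moveA (W : Matrix (Y × Fin b × Y × Y) (Y × Fin b) ℂ)
    (U : X → Matrix (Fin a' × Fin c') (Fin a × Fin c) ℂ) (φ : Reg X Y a b c → ℂ) :
    partB W (moveA U φ) = act (ctrl U) (partB W φ) := by
  ext ⟨⟨⟨x, a⟩, c⟩, rx, y, ry, y', ry', b⟩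
  simp only [act, ctrl, moveA, partB, Fintype.sum_prod_type, Matrix.of_apply, ite_mul, zero_mul,
    Finset.sum_ite_irrel, Finset.sum_const_zero, Finset.sum_ite_eq, Finset.mem_univ, if_true,
    Finset.mul_sum]
  simp only [← Fintype.sum_prod_type']
  exact Fintype.sum_equiv ⟨fun s => (s.2.2.1, s.2.2.2, s.1, s.2.1),
    fun s => (s.2.2.1, s.2.2.2, s.1, s.2.1), fun _ => rfl, fun _ => rfl⟩ _ _ fun s => by
      simp only [Equiv.coe_fn_mk]; ring

theorem kronecker_one_isometry {m n k : Type*} [Fintype m] [Fintype n] [DecidableEq n]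
    [Fintype k] [DecidableEq k] {V : Matrix m n ℂ} (h : Vᴴ * V = 1) :
    (V ⊗ₖ (1 : Matrix k k ℂ))ᴴ * (V ⊗ₖ (1 : Matrix k k ℂ)) = 1 := by
  rw [Matrix.conjTranspose_kronecker, ← Matrix.mul_kronecker_mul, h, Matrix.conjTranspose_one,
    Matrix.one_mul, Matrix.one_kronecker_one]

theorem ctrl_isometry {U : X → Matrix (Fin a' × Fin c') (Fin a × Fin c) ℂ}
    (h : ∀ x, (U x)ᴴ * U x = 1) : (ctrl U)ᴴ * ctrl U = 1 := by
  ext ⟨⟨x, a⟩, c⟩ ⟨⟨x₁, a₁⟩, c₁⟩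
  have hx := congrFun (congrFun (h x) (a, c)) (a₁, c₁)
  simp only [Matrix.mul_apply, Matrix.conjTranspose_apply, Fintype.sum_prod_type] at hx
  rcases eq_or_ne x x₁ with rfl | hne
  · rw [Matrix.one_apply] at hx ⊢
    simpa [Matrix.mul_apply, ctrl, Matrix.conjTranspose_apply, Fintype.sum_prod_type,
      Finset.sum_ite_irrel, apply_ite] using hx
  · simp only [Matrix.mul_apply, ctrl, Matrix.conjTranspose_apply, Matrix.of_apply]
    rw [Matrix.one_apply_ne (by simp [hne])]
    refine Finset.sum_eq_zero fun s _ => ?_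
    by_cases h1 : s.1.1 = x
    · have : s.1.1 ≠ x₁ := h1 ▸ hne
      simp [this]
    · simp [h1]

/-- Any operation on Alice's side and on the message sees of the input only `x`: with the
register `Y R_Y` uncorrelated to the working registers, its effect on the canonical purification
of `σ` is as large as on that of its marginal. -/
theorem nrm_act_canonPair {p : X → ℝ} {σ : X × Y → ℝ} (hσ : ∀ s, 0 ≤ σ s)
    (hσX : ∀ x, ∑ y, σ (x, y) = p x)
    (T : Matrix ((X × Fin a' × X × X) × Fin c') ((X × Fin a × X × X) × Fin c) ℂ) (z : ℂ)
    (χ : Reg X Y a b c → ℂ) (χ' : Reg X Y a' b c' → ℂ) :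
    nrm (act T (tensor (canonPair σ) χ ∘ regEquivAB) - z • (tensor (canonPair σ) χ' ∘ regEquivAB))
      = nrm (act T (tensor (canon p) χ ∘ regEquivA) - z • (tensor (canon p) χ' ∘ regEquivA)) := by
  have hp : ∀ x, 0 ≤ p x := fun x => by rw [← hσX]; exact Finset.sum_nonneg fun _ _ => hσ _
  let Ω : ∀ {a c : ℕ}, X → (Reg X Y a b c → ℂ) →
      ((X × Fin a × X × X) × Fin c) × (Y × Y × Fin b) → ℂ :=
    fun rx χ s => if s.1.1.1 = rx then
      χ (s.1.1.2.2.1, s.1.1.2.2.2, s.2.1, s.2.2.1, s.1.1.2.1, s.2.2.2, s.1.2) else 0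
  let w : X → ((X × Fin a' × X × X) × Fin c') × (Y × Y × Fin b) → ℂ :=
    fun rx => act T (Ω rx χ) - z • Ω rx χ'
  have hA : ∀ s rx k, (act T (tensor (canon p) χ ∘ regEquivA) -
      z • (tensor (canon p) χ' ∘ regEquivA)) (s, rx, k) = √(p rx) * w rx (s, k) := by
    rintro ⟨⟨x, a₁, x', rx'⟩, c₁⟩ rx ⟨y, ry, b₁⟩
    simp only [Pi.sub_apply, Pi.smul_apply, act, Function.comp_apply, w, Ω, tensor, canon,
      regEquivA, Equiv.coe_fn_mk, mul_sub, Finset.mul_sum, smul_eq_mul]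
    congr 1
    · refine Finset.sum_congr rfl fun t _ => ?_
      by_cases h : t.1.1 = rx
      · simp [h]; ring
      · simp [h]
    · by_cases h : x = rx
      · simp [h]; ring
      · simp [h]
  have hAB : ∀ s rx y ry k, (act T (tensor (canonPair σ) χ ∘ regEquivAB) -
      z • (tensor (canonPair σ) χ' ∘ regEquivAB)) (s, rx, y, ry, k)
        = (if y = ry then (√(σ (rx, y)) : ℂ) else 0) * w rx (s, k) := by
    rintro ⟨⟨x, a₁, x', rx'⟩, c₁⟩ rx y ry ⟨y', ry', b₁⟩
    simp only [Pi.sub_apply, Pi.smul_apply, act, Function.comp_apply, w, Ω, tensor, canonPair,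
      regEquivAB, Equiv.coe_fn_mk, mul_sub, Finset.mul_sum, smul_eq_mul]
    congr 1
    · refine Finset.sum_congr rfl fun t _ => ?_
      by_cases h : t.1.1 = rx
      · by_cases h' : y = ry
        · simp [h, h']; ring
        · simp [h']
      · simp [h]
    · by_cases h : x = rx
      · by_cases h' : y = ry
        · simp [h, h']; ring
        · simp [h']
      · simp [h]
  rw [← sq_eq_sq₀ (nrm_nonneg _) (nrm_nonneg _), nrm_sq_prod₃, nrm_sq_prod₃]
  refine Finset.sum_congr rfl fun s _ => Finset.sum_congr rfl fun rx _ => ?_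
  simp only [hA]
  simp only [norm_mul, mul_pow, ← Finset.mul_sum, Complex.norm_real, Real.norm_eq_abs, sq_abs,
    Real.sq_sqrt (hp rx)]
  rw [← hσX, Finset.sum_mul, Fintype.sum_prod_type]
  refine Finset.sum_congr rfl fun y _ => ?_
  rw [Fintype.sum_prod_type, Finset.sum_eq_single y]
  · simp only [hAB]
    simp [mul_pow, ← Finset.mul_sum, Real.sq_sqrt (hσ _)]
  · intro ry _ hne
    simp [hAB, hne.symm]
  · simp

/-- A move of Alice adds to the error only the two errors of her own decoupling isometries, and
these refer to the product distribution alone: undoing `V'`, moving and applying `V` is an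
operation on Alice's side, and a contraction. -/
theorem Close.applyAB_moveA {p : X → ℝ} {σ : X × Y → ℝ} (hσ : ∀ s, 0 ≤ σ s)
    (hσX : ∀ x, ∑ y, σ (x, y) = p x)
    {U : X → Matrix (Fin a' × Fin c') (Fin a × Fin c) ℂ} (hU : ∀ x, (U x)ᴴ * U x = 1)
    {V' : Matrix (X × Fin a × X × X) (X × Fin a) ℂ} (hV' : V'ᴴ * V' = 1)
    {V : Matrix (X × Fin a' × X × X) (X × Fin a') ℂ} (hV : Vᴴ * V = 1)
    {W : Matrix (Y × Fin b × Y × Y) (Y × Fin b) ℂ} {φ χ : Reg X Y a b c → ℂ} {d e' e : ℝ}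
    (hd : Close (applyAB V' W φ) (tensor (canonPair σ) χ) d)
    (he' : Close (applyA V' χ) (tensor (canon p) χ) e')
    (he : Close (applyA V (moveA U χ)) (tensor (canon p) (moveA U χ)) e) :
    Close (applyAB V W (moveA U φ)) (tensor (canonPair σ) (moveA U χ)) (d + e' + e) := by
  have hV1 := kronecker_one_isometry (k := Fin c') hV
  have hV1' := kronecker_one_isometry (k := Fin c) hV'
  rw [← close_comp_equiv_iff regEquivAB, applyAB_regEquivAB] at hd ⊢
  rw [← close_comp_equiv_iff regEquivA, applyA_regEquivA] at he' he
  rw [moveA_regEquiv] at he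
  rw [partB_moveA]
  set V₁ := V ⊗ₖ (1 : Matrix (Fin c') (Fin c') ℂ)
  set V₁' := V' ⊗ₖ (1 : Matrix (Fin c) (Fin c) ℂ)
  let T := V₁ * ctrl U * V₁'ᴴ
  have hT : IsContraction T :=
    ((isContraction_of_isometry hV1).mul (isContraction_of_isometry (ctrl_isometry hU))).mul
      (isContraction_conjTranspose hV1')
  have hTV : T * V₁' = V₁ * ctrl U := by
    simp only [T, Matrix.mul_assoc, hV1', Matrix.mul_one]
  have key : Close (act T (tensor (canon p) χ ∘ regEquivA))
      (tensor (canon p) (moveA U χ) ∘ regEquivA) (e' + e) := by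
    refine (he'.map_act hT).symm.trans ?_
    rwa [← act_mul, hTV, act_mul]
  have h1 := hd.map_act hT
  rw [← act_mul, hTV, act_mul] at h1
  rw [add_assoc]
  refine h1.trans ?_
  obtain ⟨z, hz, h⟩ := key
  exact ⟨z, hz, (nrm_act_canonPair hσ hσX T z χ (moveA U χ)).trans_le h⟩

/-! ### Exchanging Alice and Bob -/

/-- Exchange of the registers of Alice and Bob. -/
def regSwap : Reg Y X b a c ≃ Reg X Y a b c where
  toFun := fun (y, ry, x, rx, b, a, c) => (x, rx, y, ry, a, b, c)
  invFun := fun (x, rx, y, ry, a, b, c) => (y, ry, x, rx, b, a, c)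
  left_inv _ := rfl
  right_inv _ := rfl

/-- `regSwap` next to the input registers of both parties. -/
def regSwapAB : (Y × Y × X × X) × Reg Y X b a c ≃ (X × X × Y × Y) × Reg X Y a b c where
  toFun := fun ((y, ry, x, rx), s) => ((x, rx, y, ry), regSwap s)
  invFun := fun ((x, rx, y, ry), s) => ((y, ry, x, rx), regSwap s)
  left_inv _ := rfl
  right_inv _ := rfl

/-- A move of Bob: a matrix on his memory and the message, controlled by his input. -/
def moveB (U : Y → Matrix (Fin b' × Fin c') (Fin b × Fin c) ℂ) (φ : Reg X Y a b c → ℂ) :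
    Reg X Y a b' c' → ℂ :=
  fun (x, rx, y, ry, a, b, c) => ∑ b₀, ∑ c₀, U y (b, c) (b₀, c₀) * φ (x, rx, y, ry, a, b₀, c₀)

theorem moveB_regSwap (U : Y → Matrix (Fin b' × Fin c') (Fin b × Fin c) ℂ)
    (φ : Reg X Y a b c → ℂ) : moveB U φ ∘ regSwap = moveA U (φ ∘ regSwap) := rfl

theorem applyB_regSwap (W : Matrix (Y × Fin b × Y × Y) (Y × Fin b) ℂ) (φ : Reg X Y a b c → ℂ) :
    applyB W φ ∘ (Equiv.refl (Y × Y)).prodCongr regSwap = applyA W (φ ∘ regSwap) := rfl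

theorem applyA_regSwap (V : Matrix (X × Fin a × X × X) (X × Fin a) ℂ) (φ : Reg X Y a b c → ℂ) :
    applyA V φ ∘ (Equiv.refl (X × X)).prodCongr regSwap = applyB V (φ ∘ regSwap) := rfl

theorem tensor_regSwap {I : Type*} (u : I → ℂ) (φ : Reg X Y a b c → ℂ) :
    tensor u φ ∘ (Equiv.refl I).prodCongr regSwap = tensor u (φ ∘ regSwap) := rfl

theorem applyAB_regSwapAB (V : Matrix (X × Fin a × X × X) (X × Fin a) ℂ)
    (W : Matrix (Y × Fin b × Y × Y) (Y × Fin b) ℂ) (φ : Reg X Y a b c → ℂ) :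
    applyAB V W φ ∘ regSwapAB = applyAB W V (φ ∘ regSwap) := by
  ext ⟨⟨y, ry, x, rx⟩, y', ry', x', rx', b₁, a₁, c₁⟩
  simp only [applyAB, regSwapAB, regSwap, Function.comp_apply, Equiv.coe_fn_mk, Finset.mul_sum,
    ← Fintype.sum_prod_type']
  exact Fintype.sum_equiv ⟨fun s => (s.2.2.1, s.2.2.2, s.1, s.2.1),
    fun s => (s.2.2.1, s.2.2.2, s.1, s.2.1), fun _ => rfl, fun _ => rfl⟩ _ _ fun s => by
      simp only [Equiv.coe_fn_mk]; ring

theorem tensor_canonPair_regSwapAB (σ : X × Y → ℝ) (φ : Reg X Y a b c → ℂ) :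
    tensor (canonPair σ) φ ∘ regSwapAB = tensor (canonPair (σ ∘ Prod.swap)) (φ ∘ regSwap) := by
  ext ⟨⟨y, ry, x, rx⟩, s⟩
  change canonPair σ (x, rx, y, ry) * _ = canonPair (σ ∘ Prod.swap) (y, ry, x, rx) * _
  congr 1
  simp only [canonPair, and_comm, Function.comp_apply, Prod.swap_prod_mk]

theorem Close.applyAB_moveB {q : Y → ℝ} {σ : X × Y → ℝ} (hσ : ∀ s, 0 ≤ σ s)
    (hσY : ∀ y, ∑ x, σ (x, y) = q y)
    {U : Y → Matrix (Fin b' × Fin c') (Fin b × Fin c) ℂ} (hU : ∀ y, (U y)ᴴ * U y = 1)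
    {V : Matrix (X × Fin a × X × X) (X × Fin a) ℂ}
    {W' : Matrix (Y × Fin b × Y × Y) (Y × Fin b) ℂ} (hW' : W'ᴴ * W' = 1)
    {W : Matrix (Y × Fin b' × Y × Y) (Y × Fin b') ℂ} (hW : Wᴴ * W = 1) {φ χ : Reg X Y a b c → ℂ}
    {d e' e : ℝ} (hd : Close (applyAB V W' φ) (tensor (canonPair σ) χ) d)
    (he' : Close (applyB W' χ) (tensor (canon q) χ) e')
    (he : Close (applyB W (moveB U χ)) (tensor (canon q) (moveB U χ)) e) :
    Close (applyAB V W (moveB U φ)) (tensor (canonPair σ) (moveB U χ)) (d + e' + e) := by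
  rw [← close_comp_equiv_iff regSwapAB, applyAB_regSwapAB, tensor_canonPair_regSwapAB] at hd ⊢
  rw [← close_comp_equiv_iff ((Equiv.refl (Y × Y)).prodCongr regSwap), applyB_regSwap,
    tensor_regSwap] at he' he
  exact hd.applyAB_moveA (fun _ => hσ _) hσY hU hW' hW he' he

/-! ### Norms and marginals under moves and local isometries -/

theorem nrm_applyA {V : Matrix (X × Fin a × X × X) (X × Fin a) ℂ} (hV : Vᴴ * V = 1)
    (φ : Reg X Y a b c → ℂ) : nrm (applyA V φ) = nrm φ := by
  rw [← nrm_comp_equiv regEquivA, applyA_regEquivA, nrm_act_of_isometry (kronecker_one_isometry hV),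
    nrm_comp_equiv]

theorem nrm_applyB {W : Matrix (Y × Fin b × Y × Y) (Y × Fin b) ℂ} (hW : Wᴴ * W = 1)
    (φ : Reg X Y a b c → ℂ) : nrm (applyB W φ) = nrm φ := by
  rw [← nrm_comp_equiv ((Equiv.refl (Y × Y)).prodCongr regSwap), applyB_regSwap, nrm_applyA hW,
    nrm_comp_equiv]

theorem nrm_partB {W : Matrix (Y × Fin b × Y × Y) (Y × Fin b) ℂ} (hW : Wᴴ * W = 1)
    (φ : Reg X Y a b c → ℂ) : nrm (partB W φ) = nrm φ := by
  let e : ((X × Fin a) × Fin c) × (X × Y × Y × Y × Y × Fin b) ≃ (Y × Y) × Reg X Y a b c :=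
    { toFun := fun (((x, a), c), (rx, y, ry, y', ry', b)) => ((y, ry), (x, rx, y', ry', a, b, c))
      invFun := fun ((y, ry), (x, rx, y', ry', a, b, c)) => (((x, a), c), (rx, y, ry, y', ry', b))
      left_inv := fun _ => rfl
      right_inv := fun _ => rfl }
  rw [← nrm_applyB hW φ, ← nrm_comp_equiv e]
  rfl

theorem nrm_applyAB {V : Matrix (X × Fin a × X × X) (X × Fin a) ℂ} (hV : Vᴴ * V = 1)
    {W : Matrix (Y × Fin b × Y × Y) (Y × Fin b) ℂ} (hW : Wᴴ * W = 1)
    (φ : Reg X Y a b c → ℂ) : nrm (applyAB V W φ) = nrm φ := by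
  rw [← nrm_comp_equiv regEquivAB, applyAB_regEquivAB,
    nrm_act_of_isometry (kronecker_one_isometry hV), nrm_partB hW]

/-- The reduced state on the second of two registers of the pure state `v`. -/
def gram {Z K : Type*} [Fintype Z] (v : Z × K → ℂ) (k k' : K) : ℂ :=
  ∑ z, v (z, k) * star (v (z, k'))

theorem gram_eq {Z K : Type*} [Fintype Z] (v : Z × K → ℂ) (k k' : K) : gram v k k' =
    ((Matrix.of fun z k => v (z, k))ᴴ * Matrix.of fun z k => v (z, k)) k' k := by
  simp [gram, Matrix.mul_apply, mul_comm]

theorem gram_act {Z Z' K : Type*} [Fintype Z] [DecidableEq Z] [Fintype Z'] {M : Matrix Z' Z ℂ}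
    (hM : Mᴴ * M = 1) (v : Z × K → ℂ) : gram (act M v) = gram v := by
  have h : (Matrix.of fun z k => act M v (z, k)) = M * Matrix.of fun z k => v (z, k) := by
    ext z k
    simp [act, Matrix.mul_apply]
  ext k k'
  rw [gram_eq, gram_eq, h, Matrix.conjTranspose_mul, Matrix.mul_assoc, ← Matrix.mul_assoc Mᴴ, hM,
    Matrix.one_mul]

theorem gram_moveA {U : X → Matrix (Fin a' × Fin c') (Fin a × Fin c) ℂ}
    (hU : ∀ x, (U x)ᴴ * U x = 1) (φ : Reg X Y a b c → ℂ) :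
    gram (moveA U φ ∘ regEquiv) = gram (φ ∘ regEquiv) := by
  rw [moveA_regEquiv, gram_act (ctrl_isometry hU)]

theorem nrm_moveA {U : X → Matrix (Fin a' × Fin c') (Fin a × Fin c) ℂ}
    (hU : ∀ x, (U x)ᴴ * U x = 1) (φ : Reg X Y a b c → ℂ) : nrm (moveA U φ) = nrm φ := by
  rw [← nrm_comp_equiv regEquiv, moveA_regEquiv, nrm_act_of_isometry (ctrl_isometry hU),
    nrm_comp_equiv]

/-- The reduced state on `R_X`. -/
def margRX (φ : Reg X Y a b c → ℂ) : Matrix X X ℂ :=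
  marginal (fun (x, y, ry, a, b, c) rx => (x, rx, y, ry, a, b, c)) (pure φ)

theorem margRX_eq_sum_gram (φ : Reg X Y a b c → ℂ) : margRX φ = Matrix.of fun rx rx' =>
    ∑ s : Y × Y × Fin b, gram (φ ∘ regEquiv) (rx, s) (rx', s) := by
  ext rx rx'
  simp only [margRX, marginal, gram, Matrix.of_apply, pure, Matrix.vecMulVec_apply,
    Function.comp_apply, regEquiv, Equiv.coe_fn_mk, Pi.star_apply]
  rw [Finset.sum_comm, ← Fintype.sum_prod_type']
  exact Fintype.sum_equiv ⟨fun (x, y, ry, a, b, c) => (((x, a), c), (y, ry, b)),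
    fun (((x, a), c), (y, ry, b)) => (x, y, ry, a, b, c), fun _ => rfl, fun _ => rfl⟩ _ _
    fun _ => rfl

theorem margRX_eq_sum_gram_regSwap (φ : Reg X Y a b c → ℂ) : margRX φ = Matrix.of fun rx rx' =>
    ∑ s : Y × X × Fin a, gram ((φ ∘ regSwap) ∘ regEquiv)
      (s.1, s.2.1, rx, s.2.2) (s.1, s.2.1, rx', s.2.2) := by
  ext rx rx'
  simp only [margRX, marginal, gram, Matrix.of_apply, pure, Matrix.vecMulVec_apply,
    Function.comp_apply, regEquiv, regSwap, Equiv.coe_fn_mk, Pi.star_apply]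
  rw [Finset.sum_comm, ← Fintype.sum_prod_type']
  exact Fintype.sum_equiv ⟨fun (x, y, ry, a, b, c) => (((y, b), c), (ry, x, a)),
    fun (((y, b), c), (ry, x, a)) => (x, y, ry, a, b, c), fun _ => rfl, fun _ => rfl⟩ _ _
    fun _ => rfl

theorem margRX_moveA {U : X → Matrix (Fin a' × Fin c') (Fin a × Fin c) ℂ}
    (hU : ∀ x, (U x)ᴴ * U x = 1) (φ : Reg X Y a b c → ℂ) : margRX (moveA U φ) = margRX φ := by
  rw [margRX_eq_sum_gram, gram_moveA hU, ← margRX_eq_sum_gram]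

theorem margRX_moveB {U : Y → Matrix (Fin b' × Fin c') (Fin b × Fin c) ℂ}
    (hU : ∀ y, (U y)ᴴ * U y = 1) (φ : Reg X Y a b c → ℂ) : margRX (moveB U φ) = margRX φ := by
  rw [margRX_eq_sum_gram_regSwap, moveB_regSwap, gram_moveA hU, ← margRX_eq_sum_gram_regSwap]

theorem margRX_regSwap_moveB {U : Y → Matrix (Fin b' × Fin c') (Fin b × Fin c) ℂ}
    (hU : ∀ y, (U y)ᴴ * U y = 1) (φ : Reg X Y a b c → ℂ) :
    margRX (moveB U φ ∘ regSwap) = margRX (φ ∘ regSwap) := by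
  rw [moveB_regSwap, margRX_moveA hU]

theorem margRX_regSwap_moveA {U : X → Matrix (Fin a' × Fin c') (Fin a × Fin c) ℂ}
    (hU : ∀ x, (U x)ᴴ * U x = 1) (φ : Reg X Y a b c → ℂ) :
    margRX (moveA U φ ∘ regSwap) = margRX (φ ∘ regSwap) :=
  margRX_moveB hU (φ ∘ regSwap)

/-! ### Local isometries commute with moves of the other party -/

/-- A linear contraction applied to one of two registers does not increase the distance. -/
theorem Close.slicewise {S I J : Type*} [Fintype S] [Fintype I] [Fintype J]
    {f : (I → ℂ) → J → ℂ} (hf : ∀ (u v : I → ℂ) (c : ℂ), f (u - c • v) = f u - c • f v)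
    (hn : ∀ u, nrm (f u) ≤ nrm u) {u v : S × I → ℂ} {e : ℝ} (h : Close u v e) :
    Close (fun s => f (fun i => u (s.1, i)) s.2) (fun s => f (fun i => v (s.1, i)) s.2 : S × J → ℂ)
      e := by
  obtain ⟨c, hc, h⟩ := h
  refine ⟨c, hc, le_trans ?_ h⟩
  rw [← sq_le_sq₀ (nrm_nonneg _) (nrm_nonneg _), nrm_sq, nrm_sq, Fintype.sum_prod_type,
    Fintype.sum_prod_type]
  refine Finset.sum_le_sum fun s _ => ?_
  have h1 := pow_le_pow_left₀ (nrm_nonneg _) (hn ((fun i => u (s, i)) - c • fun i => v (s, i))) 2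
  rw [hf, nrm_sq, nrm_sq] at h1
  exact h1

theorem moveA_sub_smul (U : X → Matrix (Fin a' × Fin c') (Fin a × Fin c) ℂ)
    (φ χ : Reg X Y a b c → ℂ) (z : ℂ) :
    moveA U (φ - z • χ) = moveA U φ - z • moveA U χ := by
  ext ⟨x, rx, y, ry, a₁, b₁, c₁⟩
  simp only [moveA, Pi.sub_apply, Pi.smul_apply, smul_eq_mul, mul_sub, Finset.sum_sub_distrib,
    Finset.mul_sum]
  congr 1
  exact Finset.sum_congr rfl fun _ _ => Finset.sum_congr rfl fun _ _ => by ring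

theorem applyB_moveA (W : Matrix (Y × Fin b × Y × Y) (Y × Fin b) ℂ)
    (U : X → Matrix (Fin a' × Fin c') (Fin a × Fin c) ℂ) (φ : Reg X Y a b c → ℂ) :
    applyB W (moveA U φ) = fun s => moveA U (fun i => applyB W φ (s.1, i)) s.2 := by
  ext ⟨⟨y, ry⟩, x, rx, y', ry', a₁, b₁, c₁⟩
  simp only [applyB, moveA, Finset.mul_sum, ← Fintype.sum_prod_type']
  exact Fintype.sum_equiv ⟨fun s => (s.2.2.1, s.2.2.2, s.1, s.2.1),
    fun s => (s.2.2.1, s.2.2.2, s.1, s.2.1), fun _ => rfl, fun _ => rfl⟩ _ _ fun s => by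
      simp only [Equiv.coe_fn_mk]; ring

theorem tensor_moveA {S : Type*} (u : S → ℂ)
    (U : X → Matrix (Fin a' × Fin c') (Fin a × Fin c) ℂ) (φ : Reg X Y a b c → ℂ) :
    tensor u (moveA U φ) = fun s => moveA U (fun i => tensor u φ (s.1, i)) s.2 := by
  ext ⟨s, x, rx, y', ry', a₁, b₁, c₁⟩
  simp only [tensor, moveA, Finset.mul_sum]
  exact Finset.sum_congr rfl fun _ _ => Finset.sum_congr rfl fun _ _ => by ring

theorem Close.applyB_moveA {U : X → Matrix (Fin a' × Fin c') (Fin a × Fin c) ℂ}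
    (hU : ∀ x, (U x)ᴴ * U x = 1) {W : Matrix (Y × Fin b × Y × Y) (Y × Fin b) ℂ}
    {φ : Reg X Y a b c → ℂ} {u : Y × Y → ℂ} {e : ℝ} (h : Close (applyB W φ) (tensor u φ) e) :
    Close (applyB W (moveA U φ)) (tensor u (moveA U φ)) e := by
  rw [QComm.applyB_moveA, tensor_moveA]
  exact h.slicewise (moveA_sub_smul U) fun φ => (nrm_moveA hU φ).le

theorem Close.applyA_moveB {U : Y → Matrix (Fin b' × Fin c') (Fin b × Fin c) ℂ}
    (hU : ∀ y, (U y)ᴴ * U y = 1) {V : Matrix (X × Fin a × X × X) (X × Fin a) ℂ}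
    {φ : Reg X Y a b c → ℂ} {u : X × X → ℂ} {e : ℝ} (h : Close (applyA V φ) (tensor u φ) e) :
    Close (applyA V (moveB U φ)) (tensor u (moveB U φ)) e := by
  rw [← close_comp_equiv_iff ((Equiv.refl (X × X)).prodCongr regSwap), applyA_regSwap,
    tensor_regSwap] at h ⊢
  exact h.applyB_moveA hU

/-! ### Existence of decoupling isometries -/

/-- `h(ρ_{R_X Y R_Y B C}, ρ_{R_X} ⊗ ρ_{Y R_Y B C})` for the pure state `φ`. -/
def correlation (φ : Reg X Y a b c → ℂ) : ℝ :=
  hellinger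
    (marginal (fun (x, a) (rx, y, ry, b, c) => (x, rx, y, ry, a, b, c)) (pure φ) :
      Matrix (X × Y × Y × Fin b × Fin c) _ ℂ)
    (margRX φ ⊗ₖ (marginal (fun (x, rx, a) (y, ry, b, c) => (x, rx, y, ry, a, b, c)) (pure φ) :
        Matrix (Y × Y × Fin b × Fin c) _ ℂ))

/-- The amplitudes of `φ`, as a matrix from the registers `X A` to the other ones. -/
def ampMatrix (φ : Reg X Y a b c → ℂ) : Matrix (X × Y × Y × Fin b × Fin c) (X × Fin a) ℂ :=
  Matrix.of fun (rx, y, ry, b, c) (x, a) => φ (x, rx, y, ry, a, b, c)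

/-- The amplitudes of a state after Alice's local isometry, as a matrix from her registers to the
other ones. -/
def ampMatrixA (ω : (X × X) × Reg X Y a b c → ℂ) :
    Matrix (X × Y × Y × Fin b × Fin c) (X × Fin a × X × X) ℂ :=
  Matrix.of fun (rx, y, ry, b, c) (x, a, x', rx') => ω ((x, rx), (x', rx', y, ry, a, b, c))

theorem ampMatrixA_applyA (V : Matrix (X × Fin a × X × X) (X × Fin a) ℂ) (φ : Reg X Y a b c → ℂ) :
    ampMatrixA (applyA V φ) = ampMatrix φ * Vᵀ := by
  ext ⟨rx, y, ry, b₁, c₁⟩ ⟨x, a₁, x', rx'⟩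
  rw [Matrix.mul_apply, Fintype.sum_prod_type]
  exact Finset.sum_congr rfl fun _ _ => Finset.sum_congr rfl fun _ _ => mul_comm _ _

theorem dotProduct_eq_trace_ampMatrixA (ω ν : (X × X) × Reg X Y a b c → ℂ) :
    star ν ⬝ᵥ ω = ((ampMatrixA ν)ᴴ * ampMatrixA ω).trace := by
  simp only [Matrix.trace, Matrix.diag, Matrix.mul_apply]
  rw [← Fintype.sum_prod_type']
  refine Fintype.sum_equiv ⟨fun s => ((s.1.1, s.2.2.2.2.2.1, s.2.1, s.2.2.1),
      (s.1.2, s.2.2.2.1, s.2.2.2.2.1, s.2.2.2.2.2.2)),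
    fun s => ((s.1.1, s.2.1), (s.1.2.2.1, s.1.2.2.2, s.2.2.1, s.2.2.2.1, s.1.2.1, s.2.2.2.2)),
    fun _ => rfl, fun _ => rfl⟩ _ _ fun _ => rfl

theorem ampMatrixA_tensor_canon {p : X → ℝ} (hp : ∀ x, 0 ≤ p x) (φ : Reg X Y a b c → ℂ) :
    ampMatrixA (tensor (canon p) φ) * (ampMatrixA (tensor (canon p) φ))ᴴ =
      Matrix.diagonal (fun x => (p x : ℂ)) ⊗ₖ
        (marginal (fun (x, rx, a) (y, ry, b, c) => (x, rx, y, ry, a, b, c)) (pure φ) :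
          Matrix (Y × Y × Fin b × Fin c) _ ℂ) := by
  ext ⟨rx, y, ry, b₁, c₁⟩ ⟨rx₂, y₂, ry₂, b₂, c₂⟩
  rw [Matrix.kronecker_apply, Matrix.mul_apply, Fintype.sum_prod_type]
  have h1 : ∀ x, ∑ s : Fin a × X × X, ampMatrixA (tensor (canon p) φ) (rx, y, ry, b₁, c₁) (x, s) *
      (ampMatrixA (tensor (canon p) φ))ᴴ (x, s) (rx₂, y₂, ry₂, b₂, c₂) =
      (canon p (x, rx) * star (canon p (x, rx₂))) *
      marginal (fun (x, rx, a) (y, ry, b, c) => (x, rx, y, ry, a, b, c)) (pure φ)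
        (y, ry, b₁, c₁) (y₂, ry₂, b₂, c₂) := by
    intro x
    rw [marginal, Matrix.of_apply, Finset.mul_sum]
    refine Fintype.sum_equiv ⟨fun s => (s.2.1, s.2.2, s.1), fun s => (s.2.2, s.1, s.2.1),
      fun _ => rfl, fun _ => rfl⟩ _ _ fun ⟨a₁, x', rx'⟩ => ?_
    change canon p (x, rx) * φ (x', rx', y, ry, a₁, b₁, c₁) *
      star (canon p (x, rx₂) * φ (x', rx', y₂, ry₂, a₁, b₂, c₂)) =
      (canon p (x, rx) * star (canon p (x, rx₂))) *
        (φ (x', rx', y, ry, a₁, b₁, c₁) * star (φ (x', rx', y₂, ry₂, a₁, b₂, c₂)))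
    rw [star_mul']
    ring
  simp only [h1, ← Finset.sum_mul]
  congr 1
  rw [Finset.sum_eq_single rx]
  · rcases eq_or_ne rx rx₂ with rfl | h
    · simp [canon, ← Complex.ofReal_mul, Real.mul_self_sqrt (hp _)]
    · simp [canon, h]
  · intro x _ hx
    simp [canon, hx]
  · simp

/-- A state whose reduced state on `R_X` is that of `canon p` has an isometry on `X A` that brings
it as close to a product state as its correlation allows: both states compared purify the states
in the definition of `correlation`, with Alice's registers as purifying ones. -/
theorem exists_applyA_attaining {p : X → ℝ} (hp : ∀ x, 0 ≤ p x) {φ : Reg X Y a b c → ℂ}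
    (hφ : margRX φ = Matrix.diagonal fun x => (p x : ℂ)) :
    ∃ V : Matrix (X × Fin a × X × X) (X × Fin a) ℂ, Vᴴ * V = 1 ∧
      correlation φ = hellinger (pure (applyA V φ)) (pure (tensor (canon p) φ)) := by
  have hM : (marginal (fun (x, a) (rx, y, ry, b, c) => (x, rx, y, ry, a, b, c)) (pure φ) :
      Matrix (X × Y × Y × Fin b × Fin c) _ ℂ) = ampMatrix φ * (ampMatrix φ)ᴴ := rfl
  have hcard : Fintype.card (X × Fin a) ≤ Fintype.card (X × Fin a × X × X) :=
    Fintype.card_le_of_injective (fun s => (s.1, s.2, s.1, s.1)) fun s t h => by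
      simp only [Prod.mk.injEq] at h
      exact Prod.ext h.1 h.2.1
  obtain ⟨V, hV, hF⟩ := exists_isometry_overlap_eq_fidelity hcard (ampMatrix φ)
    (ampMatrixA (tensor (canon p) φ))
  refine ⟨V, hV, ?_⟩
  rw [correlation, hM, hφ, ← ampMatrixA_tensor_canon hp, hellinger, hellinger, ← hF, fidelity_pure,
    dotProduct_eq_trace_ampMatrixA, ampMatrixA_applyA]

theorem hellinger_pure_comp_equiv {I J : Type*} [Fintype I] [DecidableEq I] [Fintype J]
    [DecidableEq J] (e : J ≃ I) (u v : I → ℂ) :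
    hellinger (pure (u ∘ e)) (pure (v ∘ e)) = hellinger (pure u) (pure v) := by
  rw [hellinger, hellinger, fidelity_pure, fidelity_pure]
  congr 3
  exact Equiv.sum_comp e fun i => star v i * u i

theorem exists_applyB_attaining {q : Y → ℝ} (hq : ∀ y, 0 ≤ q y) {φ : Reg X Y a b c → ℂ}
    (hφ : margRX (φ ∘ regSwap) = Matrix.diagonal fun y => (q y : ℂ)) :
    ∃ W : Matrix (Y × Fin b × Y × Y) (Y × Fin b) ℂ, Wᴴ * W = 1 ∧
      correlation (φ ∘ regSwap) =
        hellinger (pure (applyB W φ)) (pure (tensor (canon q) φ)) := by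
  obtain ⟨W, hW, h⟩ := exists_applyA_attaining hq hφ
  refine ⟨W, hW, h.trans ?_⟩
  rw [← hellinger_pure_comp_equiv ((Equiv.refl (Y × Y)).prodCongr regSwap) (applyB W φ),
    applyB_regSwap, tensor_regSwap]

/-! ### States of a protocol -/

/-- The isometry that creates the canonical purification of `p` in fresh registers. -/
def creation (p : X → ℝ) (a : ℕ) : Matrix (X × Fin a × X × X) (X × Fin a) ℂ :=
  Matrix.of fun (x, a, x', rx') (x₀, a₀) => if x = x₀ ∧ a = a₀ then canon p (x', rx') else 0

theorem creation_isometry {p : X → ℝ} (hp : p ∈ stdSimplex ℝ X) (a : ℕ) :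
    (creation p a)ᴴ * creation p a = 1 := by
  have h : ∑ s : X × X, star (canon p s) * canon p s = 1 := by
    simp [canon, Fintype.sum_prod_type, ← Complex.ofReal_mul, Real.mul_self_sqrt (hp.1 _),
      apply_ite, ← Complex.ofReal_sum, hp.2]
  ext ⟨x, a₁⟩ ⟨x₂, a₂⟩
  rw [Matrix.mul_apply, Fintype.sum_prod_type, Finset.sum_eq_single x, Fintype.sum_prod_type,
    Finset.sum_eq_single a₁]
  · by_cases h' : x = x₂ ∧ a₁ = a₂
    · obtain ⟨rfl, rfl⟩ := h'
      simpa [creation] using h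
    · rw [Matrix.one_apply_ne (by simpa using h')]
      simp [creation, h']
  · intro a₀ _ ha
    simp [creation, ha]
  · simp
  · intro x₀ _ hx
    simp [creation, hx]
  · simp

theorem applyA_creation (p : X → ℝ) (φ : Reg X Y a b c → ℂ) (x rx x' rx' : X) (y ry : Y)
    (a₁ : Fin a) (b₁ : Fin b) (c₁ : Fin c) :
    applyA (creation p a) φ ((x, rx), (x', rx', y, ry, a₁, b₁, c₁)) =
      canon p (x', rx') * φ (x, rx, y, ry, a₁, b₁, c₁) := by
  simp [applyA, creation, ite_and]

theorem applyB_creation (q : Y → ℝ) (φ : Reg X Y a b c → ℂ) (x rx : X) (y ry y' ry' : Y)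
    (a₁ : Fin a) (b₁ : Fin b) (c₁ : Fin c) :
    applyB (creation q b) φ ((y, ry), (x, rx, y', ry', a₁, b₁, c₁)) =
      canon q (y', ry') * φ (x, rx, y, ry, a₁, b₁, c₁) := by
  simp [applyB, creation, ite_and]

theorem applyAB_creation (p : X → ℝ) (q : Y → ℝ) (φ : Reg X Y a b c → ℂ) (x rx x' rx' : X)
    (y ry y' ry' : Y) (a₁ : Fin a) (b₁ : Fin b) (c₁ : Fin c) :
    applyAB (creation p a) (creation q b) φ
      ((x, rx, y, ry), (x', rx', y', ry', a₁, b₁, c₁)) =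
      canon p (x', rx') * (canon q (y', ry') * φ (x, rx, y, ry, a₁, b₁, c₁)) := by
  simp [applyAB, creation, ite_and]

theorem canonPair_prodDist {p : X → ℝ} (hp : ∀ x, 0 ≤ p x) (q : Y → ℝ) (x rx : X) (y ry : Y) :
    canonPair (prodDist p q) (x, rx, y, ry) = canon p (x, rx) * canon q (y, ry) := by
  by_cases h : x = rx <;> by_cases h' : y = ry <;>
    simp [canonPair, canon, prodDist, h, h', Real.sqrt_mul (hp _)]

theorem nrm_canon {p : X → ℝ} (hp : p ∈ stdSimplex ℝ X) : nrm (canon p) = 1 := by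
  rw [← sq_eq_sq₀ (nrm_nonneg _) zero_le_one, nrm_sq]
  simp [canon, Fintype.sum_prod_type, apply_ite, Real.sq_sqrt (hp.1 _), hp.2]

theorem nrm_canonPair {σ : X × Y → ℝ} (hσ : σ ∈ stdSimplex ℝ (X × Y)) :
    nrm (canonPair σ) = 1 := by
  rw [← sq_eq_sq₀ (nrm_nonneg _) zero_le_one, nrm_sq]
  have h := hσ.2
  rw [Fintype.sum_prod_type] at h
  simp [canonPair, Fintype.sum_prod_type, apply_ite, ite_and, Real.sq_sqrt (hσ.1 _), h]

theorem prodDist_mem {p : X → ℝ} {q : Y → ℝ} (hp : p ∈ stdSimplex ℝ X)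
    (hq : q ∈ stdSimplex ℝ Y) : prodDist p q ∈ stdSimplex ℝ (X × Y) :=
  ⟨fun _ => mul_nonneg (hp.1 _) (hq.1 _), by
    simp [prodDist, Fintype.sum_prod_type, ← Finset.mul_sum, hq.2, hp.2]⟩

/-- For classical inputs independent of the other registers, `R_X` holds the input of Alice. -/
theorem margRX_canonPair_mul {p : X → ℝ} {σ : X × Y → ℝ} (hσ : ∀ s, 0 ≤ σ s)
    (hσX : ∀ x, ∑ y, σ (x, y) = p x) {ψ : Fin a × Fin b × Fin c → ℂ} (hψ : ∑ s, ‖ψ s‖ ^ 2 = 1)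
    {φ : Reg X Y a b c → ℂ}
    (hφ : ∀ x rx y ry s, φ (x, rx, y, ry, s) = canonPair σ (x, rx, y, ry) * ψ s) :
    margRX φ = Matrix.diagonal fun x => (p x : ℂ) := by
  ext rx rx'
  have hψ' : ∑ s, ψ s * star (ψ s) = 1 := by
    rw [← Complex.ofReal_one, ← hψ]
    push_cast
    exact Finset.sum_congr rfl fun _ _ => Complex.mul_conj' _
  have h1 : ∀ x y ry, ∑ s : Fin a × Fin b × Fin c,
      pure φ (x, rx, y, ry, s) (x, rx', y, ry, s) =
      canonPair σ (x, rx, y, ry) * star (canonPair σ (x, rx', y, ry)) := by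
    intro x y ry
    rw [← mul_one (_ * _), ← hψ', Finset.mul_sum]
    refine Finset.sum_congr rfl fun s _ => ?_
    rw [pure, Matrix.vecMulVec_apply, Pi.star_apply, hφ, hφ, star_mul']
    ring
  have h2 : margRX φ rx rx' = ∑ x, ∑ y, ∑ ry,
      canonPair σ (x, rx, y, ry) * star (canonPair σ (x, rx', y, ry)) := by
    simp only [← h1]
    simp only [margRX, marginal, Matrix.of_apply, Fintype.sum_prod_type]
  rw [h2]
  rcases eq_or_ne rx rx' with rfl | h
  · rw [Matrix.diagonal_apply_eq, ← hσX, Finset.sum_eq_single rx]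
    · simp [canonPair, apply_ite, ← Complex.ofReal_mul, Real.mul_self_sqrt (hσ _)]
    · intro x _ hx
      simp [canonPair, hx]
    · simp
  · rw [Matrix.diagonal_apply_ne _ h]
    refine Finset.sum_eq_zero fun x _ => Finset.sum_eq_zero fun y _ =>
      Finset.sum_eq_zero fun ry _ => ?_
    by_cases hx : x = rx
    · simp [canonPair, hx, h]
    · simp [canonPair, hx]

theorem nrm_eq_one_of_margRX {p : X → ℝ} (hp : ∑ x, p x = 1) {φ : Reg X Y a b c → ℂ}
    (hφ : margRX φ = Matrix.diagonal fun x => (p x : ℂ)) : nrm φ = 1 := by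
  rw [← sq_eq_sq₀ (nrm_nonneg _) zero_le_one, one_pow, nrm_sq, ← hp]
  have h : ∀ rx, ∑ s : X × Y × Y × Fin a × Fin b × Fin c,
      ‖φ (s.1, rx, s.2)‖ ^ 2 = p rx := by
    intro rx
    have h1 := congrFun (congrFun hφ rx) rx
    rw [Matrix.diagonal_apply_eq] at h1
    rw [← Complex.ofReal_inj, ← h1]
    push_cast
    exact Finset.sum_congr rfl fun _ _ => (Complex.mul_conj' _).symm
  simp only [← h]
  rw [← Fintype.sum_prod_type']
  exact Fintype.sum_equiv ⟨fun s => (s.2.1, s.1, s.2.2), fun s => (s.2.1, s.1, s.2.2),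
    fun _ => rfl, fun _ => rfl⟩ _ _ fun _ => rfl

namespace Protocol

variable {r : ℕ} (P : Protocol r X Y)

theorem sum_ent : ∑ s : Fin (P.dA 0) × Fin (P.dB 0) × Fin (P.dCB 0),
    ‖P.ent (s.1, s.2.1)‖ ^ 2 = 1 := by
  have h := P.ent_unit
  rw [Fintype.sum_prod_type] at h
  simp only [Fintype.sum_prod_type, Finset.sum_const, Finset.card_univ, Fintype.card_fin,
    P.dCB_zero, one_smul]
  exact h

theorem margRX_evenState_zero {p : X → ℝ} {σ : X × Y → ℝ} (hσ : ∀ s, 0 ≤ σ s)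
    (hσX : ∀ x, ∑ y, σ (x, y) = p x) :
    margRX (P.evenState σ 0) = Matrix.diagonal fun x => (p x : ℂ) :=
  margRX_canonPair_mul hσ hσX P.sum_ent fun _ _ _ _ _ => rfl

theorem margRX_regSwap_evenState_zero {q : Y → ℝ} {σ : X × Y → ℝ} (hσ : ∀ s, 0 ≤ σ s)
    (hσY : ∀ y, ∑ x, σ (x, y) = q y) :
    margRX (P.evenState σ 0 ∘ regSwap) = Matrix.diagonal fun y => (q y : ℂ) := by
  refine margRX_canonPair_mul (σ := σ ∘ Prod.swap) (ψ := fun s => P.ent (s.2.1, s.1))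
    (fun _ => hσ _) hσY ?_ fun y ry x rx s => ?_
  · rw [← P.sum_ent]
    exact Fintype.sum_equiv ⟨fun s => (s.2.1, s.1, s.2.2), fun s => (s.2.1, s.1, s.2.2),
      fun _ => rfl, fun _ => rfl⟩ _ _ fun _ => rfl
  · change canonPair σ (x, rx, y, ry) * P.ent (s.2.1, s.1) = _
    simp only [canonPair, and_comm, Function.comp_apply, Prod.swap_prod_mk]

end Protocol

/-! ### Accumulation of the errors over the rounds -/

/-- The accumulated error after `i` rounds, when round `i` contributes `ε i + ε (i - 2)`. -/
def accErr (ε : ℕ → ℝ) : ℕ → ℝ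
  | 0 => 0
  | i + 1 => accErr ε i + ε (i - 1) + ε (i + 1)

theorem accErr_eq {ε : ℕ → ℝ} (h0 : ε 0 = 0) {i : ℕ} (hi : 1 ≤ i) :
    accErr ε i = ε i + ε (i - 1) + 2 * ∑ j ∈ Finset.Icc 1 (i - 2), ε j := by
  induction i, hi using Nat.le_induction with
  | base => simp [accErr, h0]
  | succ i hi ih =>
    rw [accErr, ih]
    obtain ⟨k, rfl⟩ : ∃ k, i = k + 1 := ⟨i - 1, by omega⟩
    cases k with
    | zero => simp [h0, add_comm]
    | succ k =>
      simp only [Nat.reduceSubDiff, Nat.add_one_sub_one]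
      rw [Finset.sum_Icc_succ_top (by omega)]
      ring

namespace Protocol

variable {r : ℕ} (P : Protocol r X Y) {p : X → ℝ} {q : Y → ℝ} {σ : X × Y → ℝ}

theorem evenState_succ (μ : X × Y → ℝ) (k : ℕ) :
    P.evenState μ (k + 1) = moveB (P.UB k) (P.oddState μ k) := rfl

theorem oddState_eq (μ : X × Y → ℝ) (k : ℕ) :
    P.oddState μ k = moveA (P.UA k) (P.evenState μ k) := rfl

theorem margRX_evenState (hσ : ∀ s, 0 ≤ σ s) (hσX : ∀ x, ∑ y, σ (x, y) = p x) {k : ℕ}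
    (hk : 2 * k ≤ r) : margRX (P.evenState σ k) = Matrix.diagonal fun x => (p x : ℂ) := by
  induction k with
  | zero => exact P.margRX_evenState_zero hσ hσX
  | succ k ih =>
    rw [evenState_succ, margRX_moveB (P.UB_isometry k (by omega)), oddState_eq,
      margRX_moveA (P.UA_isometry k (by omega)), ih (by omega)]

theorem margRX_oddState (hσ : ∀ s, 0 ≤ σ s) (hσX : ∀ x, ∑ y, σ (x, y) = p x) {k : ℕ}
    (hk : 2 * k + 1 ≤ r) : margRX (P.oddState σ k) = Matrix.diagonal fun x => (p x : ℂ) := by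
  rw [oddState_eq, margRX_moveA (P.UA_isometry k hk), P.margRX_evenState hσ hσX (by omega)]

theorem margRX_regSwap_evenState (hσ : ∀ s, 0 ≤ σ s) (hσY : ∀ y, ∑ x, σ (x, y) = q y) {k : ℕ}
    (hk : 2 * k ≤ r) :
    margRX (P.evenState σ k ∘ regSwap) = Matrix.diagonal fun y => (q y : ℂ) := by
  induction k with
  | zero => exact P.margRX_regSwap_evenState_zero hσ hσY
  | succ k ih =>
    rw [evenState_succ, margRX_regSwap_moveB (P.UB_isometry k (by omega)), oddState_eq,
      margRX_regSwap_moveA (P.UA_isometry k (by omega)), ih (by omega)]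

theorem nrm_evenState (hσ : σ ∈ stdSimplex ℝ (X × Y)) {k : ℕ} (hk : 2 * k ≤ r) :
    nrm (P.evenState σ k) = 1 :=
  nrm_eq_one_of_margRX (by rw [← Fintype.sum_prod_type', hσ.2])
    (P.margRX_evenState hσ.1 (fun _ => rfl) hk)

theorem nrm_oddState (hσ : σ ∈ stdSimplex ℝ (X × Y)) {k : ℕ} (hk : 2 * k + 1 ≤ r) :
    nrm (P.oddState σ k) = 1 :=
  nrm_eq_one_of_margRX (by rw [← Fintype.sum_prod_type', hσ.2])
    (P.margRX_oddState hσ.1 (fun _ => rfl) hk)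

theorem eps_zero : P.eps p q 0 = 0 := by simp [eps]

theorem eps_odd (k : ℕ) :
    P.eps p q (2 * k + 1) = correlation (P.oddState (prodDist p q) k) := by
  have h : (2 * k + 1) / 2 = k := by omega
  rw [eps, if_neg (by omega), if_neg (by simp), h]
  rfl

theorem eps_even (k : ℕ) : P.eps p q (2 * k + 2) =
    correlation (P.evenState (prodDist p q) (k + 1) ∘ regSwap) := by
  have h : (2 * k + 2) / 2 = k + 1 := by omega
  have hm : ∀ {a b c : ℕ} (φ : Reg X Y a b c → ℂ),
      (marginal (fun (x, rx, y, a, b, c) ry => (x, rx, y, ry, a, b, c)) (pure φ) : Matrix Y Y ℂ) =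
        margRX (φ ∘ regSwap) := by
    intro a b c φ
    ext y y'
    exact Fintype.sum_equiv ⟨fun (x, rx, y, a, b, c) => (y, x, rx, b, a, c),
      fun (y, x, rx, b, a, c) => (x, rx, y, a, b, c), fun _ => rfl, fun _ => rfl⟩ _ _ fun _ => rfl
  rw [eps, if_neg (by omega), if_pos (by simp [parity_simps]), h, errB]
  dsimp only
  rw [hm]
  rfl

theorem jointErr_even (μ : X × Y → ℝ)
    (VA : (k : ℕ) → Matrix (X × Fin (P.dA k) × X × X) (X × Fin (P.dA k)) ℂ)
    (VB : (k : ℕ) → Matrix (Y × Fin (P.dB k) × Y × Y) (Y × Fin (P.dB k)) ℂ) (k : ℕ) :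
    P.jointErr p q μ VA VB (2 * k) =
      hellinger (pure (applyAB (VA k) (VB k) (P.evenState μ k)))
        (pure (tensor (canonPair μ) (P.evenState (prodDist p q) k))) := by
  have h : 2 * k / 2 = k := by omega
  rw [jointErr, if_pos (by simp), h]

theorem jointErr_odd (μ : X × Y → ℝ)
    (VA : (k : ℕ) → Matrix (X × Fin (P.dA k) × X × X) (X × Fin (P.dA k)) ℂ)
    (VB : (k : ℕ) → Matrix (Y × Fin (P.dB k) × Y × Y) (Y × Fin (P.dB k)) ℂ) (k : ℕ) :
    P.jointErr p q μ VA VB (2 * k + 1) =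
      hellinger (pure (applyAB (VA (k + 1)) (VB k) (P.oddState μ k)))
        (pure (tensor (canonPair μ) (P.oddState (prodDist p q) k))) := by
  have h : (2 * k + 1) / 2 = k := by omega
  rw [jointErr, if_neg (by simp), h]

theorem exists_isDecoupling (hp : p ∈ stdSimplex ℝ X) (hq : q ∈ stdSimplex ℝ Y) :
    ∃ VA VB, P.IsDecoupling p q VA VB := by
  have h0 := (prodDist_mem hp hq).1
  have hX : ∀ x, ∑ y, prodDist p q (x, y) = p x := fun x => by
    simp [prodDist, ← Finset.mul_sum, hq.2]
  have hY : ∀ y, ∑ x, prodDist p q (x, y) = q y := fun y => by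
    simp [prodDist, ← Finset.sum_mul, hp.2]
  have hA : ∀ k, ∃ V : Matrix (X × Fin (P.dA (k + 1)) × X × X) (X × Fin (P.dA (k + 1))) ℂ,
      2 * k + 1 ≤ r → Vᴴ * V = 1 ∧ P.eps p q (2 * k + 1) =
        hellinger (pure (applyA V (P.oddState (prodDist p q) k)))
          (pure (tensor (canon p) (P.oddState (prodDist p q) k))) := by
    intro k
    by_cases hk : 2 * k + 1 ≤ r
    · obtain ⟨V, hV, h⟩ := exists_applyA_attaining hp.1 (P.margRX_oddState h0 hX hk)
      exact ⟨V, fun _ => ⟨hV, (P.eps_odd k).trans h⟩⟩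
    -- beyond round `r` any matrix will do
    · exact ⟨0, fun h => absurd h hk⟩
  have hB : ∀ k, ∃ V : Matrix (Y × Fin (P.dB (k + 1)) × Y × Y) (Y × Fin (P.dB (k + 1))) ℂ,
      2 * k + 2 ≤ r → Vᴴ * V = 1 ∧ P.eps p q (2 * k + 2) =
        hellinger (pure (applyB V (P.evenState (prodDist p q) (k + 1))))
          (pure (tensor (canon q) (P.evenState (prodDist p q) (k + 1)))) := by
    intro k
    by_cases hk : 2 * k + 2 ≤ r
    · obtain ⟨V, hV, h⟩ := exists_applyB_attaining hq.1
        (P.margRX_regSwap_evenState h0 hY (k := k + 1) hk)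
      exact ⟨V, fun _ => ⟨hV, (P.eps_even k).trans h⟩⟩
    · exact ⟨0, fun h => absurd h hk⟩
  choose VA hVA using hA
  choose VB hVB using hB
  exact ⟨fun | 0 => 0 | k + 1 => VA k, fun | 0 => P.initialV q | k + 1 => VB k,
    rfl, fun k hk => (hVA k hk).1, fun k hk => (hVB k hk).1, fun k hk => (hVA k hk).2,
    fun k hk => (hVB k hk).2⟩

/-- Alice's local isometries, together with the one that creates the canonical purification of
`p` as the one for round `-1`: that round is exact, and serves as the base of the induction. -/
def extendVA (p : X → ℝ)
    (VA : (k : ℕ) → Matrix (X × Fin (P.dA k) × X × X) (X × Fin (P.dA k)) ℂ) :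
    (k : ℕ) → Matrix (X × Fin (P.dA k) × X × X) (X × Fin (P.dA k)) ℂ
  | 0 => creation p (P.dA 0)
  | k + 1 => VA (k + 1)

namespace IsDecoupling

variable {P} {VA : (k : ℕ) → Matrix (X × Fin (P.dA k) × X × X) (X × Fin (P.dA k)) ℂ}
  {VB : (k : ℕ) → Matrix (Y × Fin (P.dB k) × Y × Y) (Y × Fin (P.dB k)) ℂ}

theorem extendVA_isometry (h : P.IsDecoupling p q VA VB) (hp : p ∈ stdSimplex ℝ X) {k : ℕ}
    (hk : 2 * k ≤ r + 1) : (P.extendVA p VA k)ᴴ * P.extendVA p VA k = 1 := by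
  cases k with
  | zero => exact creation_isometry hp _
  | succ k => exact h.isometryA k (by omega)

theorem VB_isometry (h : P.IsDecoupling p q VA VB) (hq : q ∈ stdSimplex ℝ Y) {k : ℕ}
    (hk : 2 * k ≤ r) : (VB k)ᴴ * VB k = 1 := by
  cases k with
  | zero => rw [h.zero]; exact creation_isometry hq _
  | succ k => exact h.isometryB k (by omega)

theorem close_applyA_oddState (h : P.IsDecoupling p q VA VB) (hp : p ∈ stdSimplex ℝ X)
    (hq : q ∈ stdSimplex ℝ Y) {k : ℕ} (hk : 2 * k + 1 ≤ r) :
    Close (applyA (VA (k + 1)) (P.oddState (prodDist p q) k))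
      (tensor (canon p) (P.oddState (prodDist p q) k)) (P.eps p q (2 * k + 1)) := by
  have hn := P.nrm_oddState (prodDist_mem hp hq) hk
  rw [h.attainA k hk]
  exact close_hellinger (by rw [nrm_applyA (h.isometryA k hk), hn])
    (by rw [nrm_tensor, hn, nrm_canon hp, one_mul])

theorem close_applyA_evenState (h : P.IsDecoupling p q VA VB) (hp : p ∈ stdSimplex ℝ X)
    (hq : q ∈ stdSimplex ℝ Y) {k : ℕ} (hk : 2 * k ≤ r) :
    Close (applyA (P.extendVA p VA k) (P.evenState (prodDist p q) k))
      (tensor (canon p) (P.evenState (prodDist p q) k)) (P.eps p q (2 * k - 1)) := by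
  cases k with
  | zero =>
    have : applyA (P.extendVA p VA 0) (P.evenState (prodDist p q) 0) =
        tensor (canon p) (P.evenState (prodDist p q) 0) := by
      ext ⟨⟨x, rx⟩, x', rx', y, ry, a, b, c⟩
      refine (applyA_creation _ _ _ _ _ _ _ _ _ _ _).trans ?_
      simp only [evenState, tensor, canonPair_prodDist hp.1]
      ring
    rw [this, mul_zero, Nat.zero_sub, eps_zero]
    exact Close.refl _
  | succ k =>
    exact (h.close_applyA_oddState hp hq (k := k) (by omega)).applyA_moveB
      (P.UB_isometry k (by omega))

theorem close_applyB_evenState (h : P.IsDecoupling p q VA VB) (hp : p ∈ stdSimplex ℝ X)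
    (hq : q ∈ stdSimplex ℝ Y) {k : ℕ} (hk : 2 * k ≤ r) :
    Close (applyB (VB k) (P.evenState (prodDist p q) k))
      (tensor (canon q) (P.evenState (prodDist p q) k)) (P.eps p q (2 * k)) := by
  cases k with
  | zero =>
    have : applyB (VB 0) (P.evenState (prodDist p q) 0) =
        tensor (canon q) (P.evenState (prodDist p q) 0) := by
      rw [h.zero]
      ext ⟨⟨y, ry⟩, x, rx, y', ry', a, b, c⟩
      refine (applyB_creation _ _ _ _ _ _ _ _ _ _ _).trans ?_
      simp only [evenState, tensor, canonPair_prodDist hp.1]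
      ring
    rw [this, mul_zero, eps_zero]
    exact Close.refl _
  | succ k =>
    have hn := P.nrm_evenState (prodDist_mem hp hq) hk
    rw [Nat.mul_succ, h.attainB k hk]
    exact close_hellinger (by rw [nrm_applyB (h.isometryB k hk), hn])
      (by rw [nrm_tensor, hn, nrm_canon hq, one_mul])

theorem close_applyAB_oddState_of_evenState (h : P.IsDecoupling p q VA VB)
    (hp : p ∈ stdSimplex ℝ X) (hq : q ∈ stdSimplex ℝ Y) (hσ : ∀ s, 0 ≤ σ s)
    (hσX : ∀ x, ∑ y, σ (x, y) = p x) {k : ℕ} (hk : 2 * k + 1 ≤ r)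
    (hc : Close (applyAB (P.extendVA p VA k) (VB k) (P.evenState σ k))
      (tensor (canonPair σ) (P.evenState (prodDist p q) k)) (accErr (P.eps p q) (2 * k))) :
    Close (applyAB (VA (k + 1)) (VB k) (P.oddState σ k))
      (tensor (canonPair σ) (P.oddState (prodDist p q) k))
      (accErr (P.eps p q) (2 * k + 1)) :=
  hc.applyAB_moveA hσ hσX (P.UA_isometry k hk) (h.extendVA_isometry hp (by omega))
    (h.isometryA k hk) (h.close_applyA_evenState hp hq (by omega))
    (h.close_applyA_oddState hp hq hk)

theorem close_applyAB_evenState (h : P.IsDecoupling p q VA VB) (hp : p ∈ stdSimplex ℝ X)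
    (hq : q ∈ stdSimplex ℝ Y) (hσ : ∀ s, 0 ≤ σ s) (hσX : ∀ x, ∑ y, σ (x, y) = p x)
    (hσY : ∀ y, ∑ x, σ (x, y) = q y) {k : ℕ} (hk : 2 * k ≤ r) :
    Close (applyAB (P.extendVA p VA k) (VB k) (P.evenState σ k))
      (tensor (canonPair σ) (P.evenState (prodDist p q) k)) (accErr (P.eps p q) (2 * k)) := by
  induction k with
  | zero =>
    have : applyAB (P.extendVA p VA 0) (VB 0) (P.evenState σ 0) =
        tensor (canonPair σ) (P.evenState (prodDist p q) 0) := by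
      rw [h.zero]
      ext ⟨⟨x, rx, y, ry⟩, x', rx', y', ry', a, b, c⟩
      refine (applyAB_creation _ _ _ _ _ _ _ _ _ _ _ _ _ _).trans ?_
      simp only [evenState, tensor, canonPair_prodDist hp.1]
      ring
    rw [this]
    exact Close.refl _
  | succ k ih =>
    have ho := h.close_applyAB_oddState_of_evenState hp hq hσ hσX (by omega) (ih (by omega))
    exact ho.applyAB_moveB hσ hσY (P.UB_isometry k (by omega)) (h.VB_isometry hq (by omega))
      (h.isometryB k hk)
      ((h.close_applyB_evenState hp hq (by omega)).applyB_moveA (P.UA_isometry k (by omega)))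
      (h.close_applyB_evenState hp hq hk)

/-- Both bounds: `σ = p ⊗ q` itself is a distribution with the marginals `p` and `q`. -/
theorem jointErr_le (h : P.IsDecoupling p q VA VB) (hp : p ∈ stdSimplex ℝ X)
    (hq : q ∈ stdSimplex ℝ Y) (hσ : σ ∈ stdSimplex ℝ (X × Y))
    (hσX : ∀ x, ∑ y, σ (x, y) = p x) (hσY : ∀ y, ∑ x, σ (x, y) = q y) {i : ℕ} (hi : 1 ≤ i)
    (hir : i ≤ r) : P.jointErr p q σ VA VB i ≤
      P.eps p q i + P.eps p q (i - 1) + 2 * ∑ j ∈ Finset.Icc 1 (i - 2), P.eps p q j := by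
  rw [← accErr_eq P.eps_zero hi]
  have hρ := prodDist_mem hp hq
  obtain ⟨k, rfl | rfl⟩ := i.even_or_odd'
  · obtain ⟨k, rfl⟩ : ∃ j, k = j + 1 := ⟨k - 1, by omega⟩
    rw [jointErr_even]
    refine (h.close_applyAB_evenState hp hq hσ.1 hσX hσY hir).hellinger_le ?_ ?_
    · exact (nrm_applyAB (h.extendVA_isometry hp (by omega)) (h.VB_isometry hq hir) _).trans
        (P.nrm_evenState hσ hir)
    · rw [nrm_tensor, nrm_canonPair hσ, P.nrm_evenState hρ hir, one_mul]
  · rw [jointErr_odd]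
    refine (h.close_applyAB_oddState_of_evenState hp hq hσ.1 hσX hir
      (h.close_applyAB_evenState hp hq hσ.1 hσX hσY (by omega))).hellinger_le ?_ ?_
    · rw [nrm_applyAB (h.isometryA k hir) (h.VB_isometry hq (by omega)), P.nrm_oddState hσ hir]
    · rw [nrm_tensor, nrm_canonPair hσ, P.nrm_oddState hρ hir, one_mul]

end IsDecoupling

end Protocol

end

end QComm

theorem lemma5 {r : ℕ} {X Y : Type*} [Fintype X] [DecidableEq X] [Fintype Y] [DecidableEq Y]
    (P : QComm.Protocol r X Y)
    (p : X → ℝ) (q : Y → ℝ) (σ : X × Y → ℝ)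
    (hp : p ∈ stdSimplex ℝ X) (hq : q ∈ stdSimplex ℝ Y) (hσ : σ ∈ stdSimplex ℝ (X × Y))
    (hσX : ∀ x, ∑ y, σ (x, y) = p x) (hσY : ∀ y, ∑ x, σ (x, y) = q y) :
    (∃ VA VB, P.IsDecoupling p q VA VB) ∧
    ∀ VA VB, P.IsDecoupling p q VA VB →
      ∀ i : ℕ, 1 ≤ i → i ≤ r →
        P.jointErr p q (QComm.prodDist p q) VA VB i ≤
            P.eps p q i + P.eps p q (i - 1) + 2 * ∑ j ∈ Finset.Icc 1 (i - 2), P.eps p q j ∧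
        P.jointErr p q σ VA VB i ≤
            P.eps p q i + P.eps p q (i - 1) + 2 * ∑ j ∈ Finset.Icc 1 (i - 2), P.eps p q j := by
  refine ⟨P.exists_isDecoupling hp hq, fun VA VB h i hi hir =>
    ⟨h.jointErr_le hp hq (QComm.prodDist_mem hp hq) (fun x => ?_) (fun y => ?_) hi hir,
      h.jointErr_le hp hq hσ hσX hσY hi hir⟩⟩
  · simp [QComm.prodDist, ← Finset.mul_sum, hq.2]
  · simp [QComm.prodDist, ← Finset.sum_mul, hp.2]
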